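/- All graphs are finite and simple. Let $K$ be a field. For a graph $G$ with vertex set $V(G)$, let $J_G=(x_iy_j-x_jy_i : \{i,j\}\in E(G))\subset R=K[x_i,y_i : i\in V(G)]$ be its binomial edge ideal. For $S\subseteq V(G)$, let $P_S(G)\subset R$ be the ideal generated by the variables $x_i,y_i$ with $i\in S$ and by all $x_iy_j-x_jy_i$ such that $i\neq j$ lie in the same connected component of the subgraph of $G$ induced on $V(G)\setminus S$. Let $\mathcal M(G)$ be the set of all $S\subseteq V(G)$ such that $P_S(G)$ is a minimal prime ideal of $J_G$; its elements are called the cut sets of $G$. An ideal is unmixed if all its minimal primes have the same height. For $i=1,2$, let $G_i$ be a connected graph with a leaf $f_i$ (a vertex of degree one) whose neighbour $v_i$ satisfies $\deg_{G_i}(v_i)\ge 3$. Let $G=G_1\circ G_2$ be the graph obtained from the disjoint union of $G_1$ and $G_2$ by identifying $v_1$ and $v_2$ to one vertex $v$ and removing the leaves $f_1$ and $f_2$; after this identification we write $V(G_1)\cap V(G_2)=\{v\}$. Consider the condition $(\ast)$ for each $i=1,2$ there exists a neighbour $u_i$ of $v$ in $G_i$ with $\deg_{G_i}(u_i)=2$.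 Then the following hold. (1) If $(\ast)$ holds, then $\mathcal M(G)=\mathcal A\cup\mathcal B$, where $$\mathcal A=\{S_1\cup S_2 : S_i\in\mathcal M(G_i),\ i=1,2,\ v\notin S_1\cup S_2\},\qquad \mathcal B=\{S_1\cup S_2 : S_i\in\mathcal M(G_i),\ i=1,2,\ S_1\cap S_2=\{v\}\}.$$ (2) If $(\ast)$ holds and $J_{G_1}$ and $J_{G_2}$ are unmixed, then $J_G$ is unmixed. (3) Conversely, if $G$ is bipartite and $J_G$ is unmixed, then $J_{G_1}$ and $J_{G_2}$ are unmixed and $(\ast)$ holds. In particular, in this case $\mathcal M(G)=\mathcal A\cup\mathcal B$. -/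

import Mathlib

open MvPolynomial

/-- The polynomial ring `K[x_i, y_i : i ∈ V]`. -/
abbrev EdgeRing (K V : Type*) [Field K] : Type _ := MvPolynomial (V ⊕ V) K

/-- The variable `x_i`. -/
noncomputable def xVar (K : Type*) {V : Type*} [Field K] (i : V) : EdgeRing K V := X (Sum.inl i)

/-- The variable `y_i`. -/
noncomputable def yVar (K : Type*) {V : Type*} [Field K] (i : V) : EdgeRing K V := X (Sum.inr i)

/-- The binomial edge ideal `J_G = (x_i y_j - x_j y_i : {i, j} an edge of G)`. -/
noncomputable def binomialEdgeIdeal (K : Type*) {V : Type*} [Field K] (G : SimpleGraph V) :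
    Ideal (EdgeRing K V) :=
  Ideal.span {p | ∃ i j, G.Adj i j ∧ p = xVar K i * yVar K j - xVar K j * yVar K i}

/-- The disjoint union of the complete graphs on the connected components of the subgraph
of `G` induced on the complement of `S` (the vertices of `S` are isolated). -/
def componentCompletion {V : Type*} (G : SimpleGraph V) (S : Set V) : SimpleGraph V where
  Adj a b := a ≠ b ∧ ∃ (ha : a ∈ Sᶜ) (hb : b ∈ Sᶜ), (G.induce Sᶜ).Reachable ⟨a, ha⟩ ⟨b, hb⟩
  symm := ⟨fun _ _ ⟨hne, ha, hb, h⟩ => ⟨hne.symm, hb, ha, h.symm⟩⟩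
  loopless := ⟨fun _ h => h.1 rfl⟩

/-- The ideal `P_S(G)`, generated by the variables `x_i, y_i` with `i ∈ S` and the binomial edge
ideals of the complete graphs on the connected components of `G` minus `S`. -/
noncomputable def cutIdeal (K : Type*) {V : Type*} [Field K] (G : SimpleGraph V) (S : Set V) :
    Ideal (EdgeRing K V) :=
  Ideal.span {p | ∃ i ∈ S, p = xVar K i ∨ p = yVar K i} ⊔
    binomialEdgeIdeal K (componentCompletion G S)

/-- The set `M(G)` of cut sets of `G`: the `S ⊆ V(G)` for which `P_S(G)` is a minimal prime
of `J_G`. -/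
def cutSets (K : Type*) {V : Type*} [Field K] (G : SimpleGraph V) : Set (Set V) :=
  {S | cutIdeal K G S ∈ (binomialEdgeIdeal K G).minimalPrimes}

/-- An ideal is unmixed if all its minimal primes have the same height. -/
def Ideal.IsUnmixed {R : Type*} [CommRing R] (I : Ideal R) : Prop :=
  ∀ P ∈ I.minimalPrimes, ∀ Q ∈ I.minimalPrimes, P.height = Q.height

/-- The disjoint union of `V₁` and `V₂` with `v₁` and `v₂` identified: the copy of `v₂` is dropped
and `v₁` is kept as the common point. -/
abbrev Glued (V₁ : Type*) {V₂ : Type*} (v₂ : V₂) : Type _ := V₁ ⊕ {w : V₂ // w ≠ v₂}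

/-- The inclusion of `V₁` in the glued vertex set. -/
def gluedLeft {V₁ V₂ : Type*} (v₂ : V₂) (a : V₁) : Glued V₁ v₂ := Sum.inl a

open Classical in
/-- The inclusion of `V₂` in the glued vertex set; it sends `v₂` to the point `v₁`. -/
noncomputable def gluedRight {V₁ V₂ : Type*} (v₁ : V₁) (v₂ : V₂) (b : V₂) : Glued V₁ v₂ :=
  if h : b = v₂ then Sum.inl v₁ else Sum.inr ⟨b, h⟩

/-- The vertex set of `(G₁, f₁) ∘ (G₂, f₂)`: glue `v₁` with `v₂` and remove `f₁` and `f₂`. -/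
def circVerts {V₁ V₂ : Type*} (f₁ v₁ : V₁) (f₂ v₂ : V₂) : Set (Glued V₁ v₂) :=
  {gluedLeft v₂ f₁, gluedRight v₁ v₂ f₂}ᶜ

/-- The graph `(G₁, f₁) ∘ (G₂, f₂)`, where `fᵢ` is a leaf of `Gᵢ` with neighbour `vᵢ`: identify
`v₁` with `v₂` and remove the leaves `f₁` and `f₂`. -/
noncomputable def circ {V₁ V₂ : Type*} (G₁ : SimpleGraph V₁) (G₂ : SimpleGraph V₂) (f₁ v₁ : V₁) (f₂ v₂ : V₂) :
    SimpleGraph (circVerts f₁ v₁ f₂ v₂) :=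
  (G₁.map (gluedLeft v₂) ⊔ G₂.map (gluedRight v₁ v₂)).induce (circVerts f₁ v₁ f₂ v₂)

/-- The family of all `S₁ ∪ S₂`, as subsets of the glued vertex set with common point `v`, where
`Sᵢ` is a cut set of `Gᵢ` and either `v ∉ S₁ ∪ S₂` or `S₁ ∩ S₂ = {v}`. -/
def gluedCutSets (K : Type*) [Field K] {V₁ V₂ : Type*} (G₁ : SimpleGraph V₁)
    (G₂ : SimpleGraph V₂) (v₁ : V₁) (v₂ : V₂) : Set (Set (Glued V₁ v₂)) :=
  {S | ∃ S₁ ∈ cutSets K G₁, ∃ S₂ ∈ cutSets K G₂,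
      gluedLeft v₂ v₁ ∉ gluedLeft v₂ '' S₁ ∪ gluedRight v₁ v₂ '' S₂ ∧
      S = gluedLeft v₂ '' S₁ ∪ gluedRight v₁ v₂ '' S₂} ∪
  {S | ∃ S₁ ∈ cutSets K G₁, ∃ S₂ ∈ cutSets K G₂,
      gluedLeft v₂ '' S₁ ∩ gluedRight v₁ v₂ '' S₂ = {gluedLeft v₂ v₁} ∧
      S = gluedLeft v₂ '' S₁ ∪ gluedRight v₁ v₂ '' S₂}

/-! The algebra is first removed. Each $P_S(G)$ is an ideal of variables and $2\times 2$ minors of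
columns with equal label, hence the kernel of a toric parametrization and prime (`ker_labelHom`).
Inclusions between such ideals are combinatorial, so $S$ is a cut set exactly when every $i\in S$
has two neighbours outside $S$ in different components of $G-S$ (`mem_cutSets_iff`). Since the
height of $P_S(G)$ is $|S|+|V|-c(G-S)$, a connected $G$ has unmixed $J_G$ exactly when
$c(G-S)=|S|+1$ for all cut sets (`isUnmixed_iff`).

The graph $G_1\circ G_2$ is the wedge at $v$ of $H_i=G_i-f_i$, and $G_i$ itself is the wedge of
$H_i$ and an edge. The excess $c(G-S)-|S|-1$ of a wedge is the sum of two defects, one for each side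
(`IsWedge.avoidComponents_eq`), and an edge contributes $0$. Thus $J_{G_i}$ is unmixed iff all
pointed cuts of $(H_i,v)$ have defect $0$ (`isUnmixed_iff_of_leaf`). Pointed cuts that agree at $v$
always glue to a cut set; a neighbour of $v$ of degree two on each side makes every cut set arise in
this way (`IsWedge.forall_cutAt_iff`). This gives (1) and (2).

For (3), the defects of $\{v\}$ on the two sides are nonnegative with sum $0$, so both vanish.
Completing a pointed cut of one side by $\emptyset$ or $\{v\}$ on the other then shows that its
defect is $0$. If $v$ had no neighbour of degree two in $H_1$, let $Y$ be the non-leaves of $H_1$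
coloured unlike $v$, and $X$ the non-leaves of $H_2$ coloured like $v$. Then $Y$ is a cut of $H_1$
and $Y\cup X$, which contains $v$, is a cut set of the wedge. But all neighbours of $v$ in $H_1$ lie
in $Y$, so adding $v$ to $Y$ lowers the left defect from $0$ to $-1$, a contradiction
(`IsWedge.exists_isDegreeTwoNeighbor_left`). -/

/-! ### Ideals of variables and minors of equally labelled columns: primality and inclusions. -/

section LabelIdeal

open Finset in
lemma prod_pow_add_single {V A : Type*} [Fintype V] [DecidableEq V] [CommRing A] (x : V → A)
    (a : V → ℕ) (k : V) :
    ∏ i, x i ^ ((a + Pi.single k 1 : V → ℕ) i) = x k * ∏ i, x i ^ a i := by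
  simp only [Pi.add_apply, pow_add, prod_mul_distrib]
  rw [mul_comm]
  congr 1
  rw [Finset.prod_eq_single k] <;> simp +contextual

lemma exists_eq_add_single {V : Type*} [DecidableEq V] (a : V → ℕ) (k : V) (h : a k ≠ 0) :
    ∃ b : V → ℕ, a = b + Pi.single k 1 := by
  refine ⟨a - Pi.single k 1, ?_⟩
  ext i
  by_cases hi : i = k
  · subst hi; simp; omega
  · simp [hi]

/-- Two monomials in the entries of a `2 × n` matrix agree as soon as they have the same
column degrees and the same row degrees on each block of columns, provided the minors of two
columns in the same block vanish. -/
lemma prod_pow_eq_of_minors_eq_zero {V ι A : Type*} [Fintype V] [DecidableEq ι] [CommRing A]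
    (l : V → ι) (x y : V → A) (hxy : ∀ i j, l i = l j → x i * y j = x j * y i)
    (n : ℕ) (α β α' β' : V → ℕ) (hn : ∑ i, α i = n) (hcol : ∀ i, α i + β i = α' i + β' i)
    (hrow : ∀ c, ∑ i with l i = c, α i = ∑ i with l i = c, α' i) :
    (∏ i, x i ^ α i) * ∏ i, y i ^ β i = (∏ i, x i ^ α' i) * ∏ i, y i ^ β' i := by
  classical
  induction n generalizing α β α' β' with
  | zero =>
    have h0 : α = 0 := by
      ext i
      simpa using (Finset.sum_eq_zero_iff.mp hn) i (Finset.mem_univ i)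
    have h0' : α' = 0 := by
      ext i
      have := hrow (l i)
      simp only [h0, Pi.zero_apply, Finset.sum_const_zero] at this
      exact (Finset.sum_eq_zero_iff.mp this.symm) i (by simp)
    have hβ : β = β' := by
      ext i
      simpa [h0, h0'] using hcol i
    rw [h0, h0', hβ]
  | succ n ih =>
    obtain ⟨i, hi⟩ : ∃ i, α i ≠ 0 := by
      by_contra! h
      simp [h] at hn
    obtain ⟨a, rfl⟩ := exists_eq_add_single α i hi
    have hna : ∑ i, a i = n := by
      simp [Finset.sum_add_distrib] at hn
      exact hn
    -- If `x i` is missing on the right, the row degree of its block supplies some `x j` with the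
    -- same label there, and the column degree supplies `y i`. The minor trades `x j * y i` for `x i
    -- * y j`, after which `x i` can be split off on both sides.
    by_cases hi' : α' i = 0
    · obtain ⟨j, hj, hj'⟩ : ∃ j, l j = l i ∧ α' j ≠ 0 := by
        by_contra! h
        have h1 := hrow (l i)
        have h2 : ∑ k with l k = l i, α' k = 0 :=
          Finset.sum_eq_zero (by simpa using h)
        rw [h2] at h1
        exact hi (Finset.sum_eq_zero_iff.mp h1 i (by simp))
      obtain ⟨a', rfl⟩ := exists_eq_add_single α' j hj'
      obtain ⟨b', rfl⟩ := exists_eq_add_single β' i (by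
        have := hcol i
        omega)
      have key := ih a β a' (b' + Pi.single j 1) hna
        (fun k => by have := hcol k; simp only [Pi.add_apply] at this ⊢; omega)
        (fun c => by
          have := hrow c
          simp only [Pi.add_apply, Finset.sum_add_distrib] at this
          have e : ∑ k with l k = c, (Pi.single i 1 : V → ℕ) k =
              ∑ k with l k = c, (Pi.single j 1 : V → ℕ) k := by
            simp [hj]
          omega)
      rw [prod_pow_add_single] at key ⊢
      rw [prod_pow_add_single, prod_pow_add_single, mul_assoc, key]
      linear_combination ((∏ k, x k ^ a' k) * ∏ k, y k ^ b' k) * hxy i j hj.symm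
    · obtain ⟨a', rfl⟩ := exists_eq_add_single α' i hi'
      have key := ih a β a' β' hna
        (fun k => by have := hcol k; simp only [Pi.add_apply] at this ⊢; omega)
        (fun c => by
          have := hrow c
          simp only [Pi.add_apply, Finset.sum_add_distrib] at this
          omega)
      rw [prod_pow_add_single, prod_pow_add_single, mul_assoc, key, mul_assoc]

variable (K : Type*) {V ι : Type*} [Field K]

/-- The ideal generated by the variables `x_i, y_i` with `i ∈ S` and the minors of the columns
`i, j` with the same label. -/
noncomputable def labelIdeal (S : Set V) (l : V → ι) : Ideal (EdgeRing K V) :=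
  Ideal.span ({p | ∃ i ∈ S, p = xVar K i ∨ p = yVar K i} ∪
    {p | ∃ i j, l i = l j ∧ p = xVar K i * yVar K j - xVar K j * yVar K i})

variable {K}

lemma labelIdeal_le {S : Set V} {l : V → ι} {I : Ideal (EdgeRing K V)} :
    labelIdeal K S l ≤ I ↔ (∀ i ∈ S, xVar K i ∈ I ∧ yVar K i ∈ I) ∧
      ∀ i j, l i = l j → xVar K i * yVar K j - xVar K j * yVar K i ∈ I := by
  rw [labelIdeal, Ideal.span_le]
  constructor
  · intro h
    exact ⟨fun i hi => ⟨h (.inl ⟨i, hi, .inl rfl⟩), h (.inl ⟨i, hi, .inr rfl⟩)⟩,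
      fun i j hij => h (.inr ⟨i, j, hij, rfl⟩)⟩
  · rintro ⟨h1, h2⟩ p (⟨i, hi, rfl | rfl⟩ | ⟨i, j, hij, rfl⟩)
    exacts [(h1 i hi).1, (h1 i hi).2, h2 i j hij]

lemma xVar_mem_labelIdeal {S : Set V} (l : V → ι) {i : V} (hi : i ∈ S) :
    xVar K i ∈ labelIdeal K S l := ((labelIdeal_le.mp le_rfl).1 i hi).1

lemma yVar_mem_labelIdeal {S : Set V} (l : V → ι) {i : V} (hi : i ∈ S) :
    yVar K i ∈ labelIdeal K S l := ((labelIdeal_le.mp le_rfl).1 i hi).2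

lemma minor_mem_labelIdeal (S : Set V) {l : V → ι} {i j : V} (hij : l i = l j) :
    xVar K i * yVar K j - xVar K j * yVar K i ∈ labelIdeal K S l :=
  (labelIdeal_le.mp le_rfl).2 i j hij

open Classical in
/-- The parametrization `x_i ↦ t_i a_{l i}`, `y_i ↦ t_i b_{l i}` (and `0` for `i ∈ S`), whose
kernel is `labelIdeal K S l`. -/
noncomputable def labelHom (K : Type*) [Field K] (S : Set V) (l : V → ι) :
    EdgeRing K V →ₐ[K] MvPolynomial (V ⊕ (ι ⊕ ι)) K :=
  aeval (Sum.elim (fun i => if i ∈ S then 0 else X (.inl i) * X (.inr (.inl (l i))))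
    (fun i => if i ∈ S then 0 else X (.inl i) * X (.inr (.inr (l i)))))

/-- The exponent vector of the image of a monomial under `labelHom`. -/
noncomputable def labelExp [Fintype V] (l : V → ι) (m : V ⊕ V →₀ ℕ) : V ⊕ (ι ⊕ ι) →₀ ℕ :=
  ∑ i, (m (.inl i) • (Finsupp.single (.inl i) 1 + Finsupp.single (.inr (.inl (l i))) 1) +
    m (.inr i) • (Finsupp.single (.inl i) 1 + Finsupp.single (.inr (.inr (l i))) 1))

lemma labelExp_inl [Fintype V] (l : V → ι) (m : V ⊕ V →₀ ℕ) (i : V) :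
    labelExp l m (.inl i) = m (.inl i) + m (.inr i) := by
  classical
  simp [labelExp, Finsupp.single_apply, Finset.sum_add_distrib]

lemma labelExp_inr_inl [Fintype V] [DecidableEq ι] (l : V → ι) (m : V ⊕ V →₀ ℕ) (c : ι) :
    labelExp l m (.inr (.inl c)) = ∑ i with l i = c, m (.inl i) := by
  classical
  simp [labelExp, Finsupp.finsetSum_apply, Finsupp.single_apply, Finset.sum_filter]

lemma monomial_eq_prod_xVar_yVar [Fintype V] (m : V ⊕ V →₀ ℕ) :
    (monomial m 1 : EdgeRing K V) =
      (∏ i, xVar K i ^ m (.inl i)) * ∏ i, yVar K i ^ m (.inr i) := by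
  rw [monomial_eq, Finsupp.prod_fintype _ _ (by simp), Fintype.prod_sum_type]
  simp [xVar, yVar]

lemma labelHom_monomial [Fintype V] (S : Set V) (l : V → ι) (m : V ⊕ V →₀ ℕ)
    (hm : ∀ i ∈ S, m (.inl i) = 0 ∧ m (.inr i) = 0) :
    labelHom K S l (monomial m 1) = monomial (labelExp l m) 1 := by
  classical
  rw [monomial_eq_prod_xVar_yVar, labelExp, monomial_sum_one, map_mul, map_prod, map_prod,
    ← Finset.prod_mul_distrib]
  refine Finset.prod_congr rfl fun i _ => ?_
  by_cases hi : i ∈ S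
  · simp [hm i hi]
  · have e (s t : V ⊕ (ι ⊕ ι)) (k : ℕ) :
        (monomial (k • (Finsupp.single s 1 + Finsupp.single t 1)) 1 :
          MvPolynomial (V ⊕ (ι ⊕ ι)) K) = (X s * X t) ^ k := by
      simp [X, monomial_pow, monomial_mul]
    have e2 (a b : V ⊕ (ι ⊕ ι) →₀ ℕ) : (monomial (a + b) 1 : MvPolynomial (V ⊕ (ι ⊕ ι)) K) =
        monomial a 1 * monomial b 1 := by simp [monomial_mul]
    rw [e2, e, e]
    simp [labelHom, xVar, yVar, hi]

lemma monomial_mem_labelIdeal [Fintype V] (S : Set V) (l : V → ι) (m : V ⊕ V →₀ ℕ)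
    (hm : ¬ ∀ i ∈ S, m (.inl i) = 0 ∧ m (.inr i) = 0) :
    (monomial m 1 : EdgeRing K V) ∈ labelIdeal K S l := by
  push Not at hm
  obtain ⟨i, hi, hm⟩ := hm
  rw [monomial_eq_prod_xVar_yVar]
  by_cases h0 : m (.inl i) = 0
  · refine Ideal.mul_mem_left _ _ (Ideal.mem_of_dvd _
      (Finset.dvd_prod_of_mem _ (Finset.mem_univ i)) ?_)
    exact Ideal.pow_mem_of_mem _ (yVar_mem_labelIdeal l hi) _ (Nat.pos_of_ne_zero (hm h0))
  · refine Ideal.mul_mem_right _ _ (Ideal.mem_of_dvd _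
      (Finset.dvd_prod_of_mem _ (Finset.mem_univ i)) ?_)
    exact Ideal.pow_mem_of_mem _ (xVar_mem_labelIdeal l hi) _ (Nat.pos_of_ne_zero h0)

lemma labelIdeal_le_ker (S : Set V) (l : V → ι) :
    labelIdeal K S l ≤ RingHom.ker (labelHom K S l) := by
  refine labelIdeal_le.mpr ⟨fun i hi => ?_, fun i j hij => ?_⟩
  · simp [labelHom, xVar, yVar, hi]
  · by_cases hi : i ∈ S <;> by_cases hj : j ∈ S <;>
      simp [labelHom, xVar, yVar, hi, hj, hij]
    ring

/-- The quotient map factors linearly through `labelHom`. Monomials free of $S$ go to monomials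
whose exponents record column degrees and blockwise row degrees, and monomials with equal data are
congruent modulo the minors. So choosing any preimage of an exponent defines the factoring map on
the monomial basis. -/
lemma ker_labelHom [Fintype V] (S : Set V) (l : V → ι) :
    RingHom.ker (labelHom K S l) = labelIdeal K S l := by
  classical
  refine le_antisymm (fun f hf => ?_) (labelIdeal_le_ker S l)
  let good (m : V ⊕ V →₀ ℕ) : Prop := ∀ i ∈ S, m (.inl i) = 0 ∧ m (.inr i) = 0
  let mk := Ideal.Quotient.mkₐ K (labelIdeal K S l)
  let L : MvPolynomial (V ⊕ (ι ⊕ ι)) K →ₗ[K] (EdgeRing K V ⧸ labelIdeal K S l) :=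
    (basisMonomials (V ⊕ (ι ⊕ ι)) K).constr K fun e =>
      if h : ∃ m, good m ∧ labelExp l m = e then mk (monomial h.choose 1) else 0
  have hL : L ∘ₗ (labelHom K S l).toLinearMap = mk.toLinearMap := by
    refine (basisMonomials (V ⊕ V) K).ext fun m => ?_
    simp only [coe_basisMonomials, LinearMap.comp_apply, AlgHom.toLinearMap_apply]
    by_cases hm : good m
    · rw [labelHom_monomial S l m hm]
      have h : ∃ m', good m' ∧ labelExp l m' = labelExp l m := ⟨m, hm, rfl⟩
      have e1 : L (monomial (labelExp l m) 1) = mk (monomial h.choose 1) := by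
        have := (basisMonomials (V ⊕ (ι ⊕ ι)) K).constr_basis K (fun e =>
          if h : ∃ m, good m ∧ labelExp l m = e then mk (monomial h.choose 1) else 0)
          (labelExp l m)
        rw [dif_pos h] at this
        simpa [L] using this
      rw [e1]
      have h2 := h.choose_spec.2
      rw [monomial_eq_prod_xVar_yVar, monomial_eq_prod_xVar_yVar]
      simp only [map_mul, map_prod, map_pow]
      refine prod_pow_eq_of_minors_eq_zero l (fun i => mk (xVar K i)) (fun i => mk (yVar K i))
        (fun i j hij => ?_) _ _ _ _ _ rfl (fun i => ?_) (fun c => ?_)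
      · rw [← sub_eq_zero, ← map_mul, ← map_mul, ← map_sub]
        exact Ideal.Quotient.eq_zero_iff_mem.mpr (minor_mem_labelIdeal S hij)
      · rw [← labelExp_inl l, ← labelExp_inl l, h2]
      · have := DFunLike.congr_fun h2 (.inr (.inl c))
        rw [labelExp_inr_inl, labelExp_inr_inl] at this
        convert! this
    · have h0 := monomial_mem_labelIdeal (K := K) S l m hm
      rw [(RingHom.mem_ker).mp (labelIdeal_le_ker S l h0), map_zero]
      exact (Ideal.Quotient.eq_zero_iff_mem.mpr h0).symm
  have : mk f = 0 := by
    have := LinearMap.congr_fun hL f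
    simp only [LinearMap.comp_apply, AlgHom.toLinearMap_apply] at this
    rw [← this, RingHom.mem_ker.mp hf, map_zero]
  exact Ideal.Quotient.eq_zero_iff_mem.mp this

instance labelIdeal_isPrime [Finite V] (S : Set V) (l : V → ι) :
    (labelIdeal K S l).IsPrime := by
  have := Fintype.ofFinite V
  rw [← ker_labelHom]
  exact RingHom.ker_isPrime _

/-- If `c` is a label, the point with columns `(1, 0)` for label `c`, `(0, 1)` for the other
labels and `(0, 0)` on `S` is a zero of `labelIdeal K S l`. -/
lemma exists_eval_labelIdeal (S : Set V) (l : V → ι) (c : ι) :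
    ∃ φ : EdgeRing K V →ₐ[K] K, labelIdeal K S l ≤ RingHom.ker φ ∧
      (∀ i ∉ S, l i = c → φ (xVar K i) = 1 ∧ φ (yVar K i) = 0) ∧
      ∀ i ∉ S, l i ≠ c → φ (xVar K i) = 0 ∧ φ (yVar K i) = 1 := by
  classical
  refine ⟨aeval (Sum.elim (fun i => if i ∈ S then 0 else if l i = c then 1 else 0)
    (fun i => if i ∈ S then 0 else if l i = c then 0 else 1)),
    labelIdeal_le.mpr ⟨fun i hi => ?_, fun i j hij => ?_⟩, fun i hi h => ?_, fun i hi h => ?_⟩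
  · simp [xVar, yVar, hi]
  · by_cases hi : i ∈ S <;> by_cases hj : j ∈ S <;> by_cases hc : l j = c <;>
      simp [xVar, yVar, hi, hj, hij, hc]
  · simp [xVar, yVar, hi, h]
  · simp [xVar, yVar, hi, h]

lemma var_mem_labelIdeal_iff {S : Set V} {l : V → ι} {i : V} :
    (xVar K i ∈ labelIdeal K S l ∧ yVar K i ∈ labelIdeal K S l) ↔ i ∈ S := by
  refine ⟨fun h => ?_, fun h => ⟨xVar_mem_labelIdeal l h, yVar_mem_labelIdeal l h⟩⟩
  by_contra hi
  obtain ⟨φ, h1, h2, -⟩ := exists_eval_labelIdeal (K := K) S l (l i)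
  have := (RingHom.mem_ker).mp (h1 h.1)
  rw [(h2 i hi rfl).1] at this
  exact one_ne_zero this

lemma xVar_notMem_labelIdeal {S : Set V} {l : V → ι} {i : V} (hi : i ∉ S) :
    xVar K i ∉ labelIdeal K S l := by
  intro h
  obtain ⟨φ, h1, h2, -⟩ := exists_eval_labelIdeal (K := K) S l (l i)
  have := (RingHom.mem_ker).mp (h1 h)
  rw [(h2 i hi rfl).1] at this
  exact one_ne_zero this

lemma minor_mem_labelIdeal_iff {S : Set V} {l : V → ι} {i j : V} (hi : i ∉ S) (hj : j ∉ S) :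
    xVar K i * yVar K j - xVar K j * yVar K i ∈ labelIdeal K S l ↔ l i = l j := by
  refine ⟨fun h => ?_, minor_mem_labelIdeal S⟩
  by_contra hij
  obtain ⟨φ, h1, h2, h3⟩ := exists_eval_labelIdeal (K := K) S l (l i)
  have := (RingHom.mem_ker).mp (h1 h)
  simp [(h2 i hi rfl), h3 j hj (Ne.symm hij)] at this

/-- Evaluation at points with columns $(1,0)$, $(0,1)$ and $(0,0)$ detects which generators lie in
the larger ideal. Labels on `T` play no role, since a minor with a column in `T` lies in the ideal
anyway. -/
lemma labelIdeal_le_labelIdeal_iff {ι' : Type*} {S T : Set V} {l : V → ι} {l' : V → ι'} :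
    labelIdeal K S l ≤ labelIdeal K T l' ↔
      S ⊆ T ∧ ∀ i ∉ T, ∀ j ∉ T, l i = l j → l' i = l' j := by
  rw [labelIdeal_le]
  refine ⟨fun ⟨h1, h2⟩ => ⟨fun i hi => var_mem_labelIdeal_iff.mp (h1 i hi),
    fun i hi j hj hij => (minor_mem_labelIdeal_iff hi hj).mp (h2 i j hij)⟩,
    fun ⟨h1, h2⟩ => ⟨fun i hi => var_mem_labelIdeal_iff.mpr (h1 hi), fun i j hij => ?_⟩⟩
  by_cases hi : i ∈ T
  · exact sub_mem (Ideal.mul_mem_right _ _ (xVar_mem_labelIdeal l' hi))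
      (Ideal.mul_mem_left _ _ (yVar_mem_labelIdeal l' hi))
  by_cases hj : j ∈ T
  · exact sub_mem (Ideal.mul_mem_left _ _ (yVar_mem_labelIdeal l' hj))
      (Ideal.mul_mem_right _ _ (xVar_mem_labelIdeal l' hj))
  exact minor_mem_labelIdeal T (h2 i hi j hj hij)

lemma labelIdeal_lt {ι' : Type*} {S T : Set V} {l : V → ι} {l' : V → ι'}
    (h : labelIdeal K S l ≤ labelIdeal K T l')
    (h' : ¬ (T ⊆ S ∧ ∀ i ∉ S, ∀ j ∉ S, l' i = l' j → l i = l j)) :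
    labelIdeal K S l < labelIdeal K T l' :=
  lt_of_le_not_ge h (by rwa [labelIdeal_le_labelIdeal_iff])

end LabelIdeal

/-! ### Heights: Krull's theorem from above, chains of primes from below. -/

section Height

variable {K : Type*} {V : Type*} [Field K]

lemma labelIdeal_mono_left {S T : Set V} (h : S ⊆ T) (l : V → V) :
    labelIdeal K S l ≤ labelIdeal K T l :=
  labelIdeal_le_labelIdeal_iff.mpr ⟨h, fun _ _ _ _ h => h⟩

/-- Merging the elements of `W` one at a time into the block of their representative gives a
strictly increasing chain of primes. -/
lemma card_le_height_labelIdeal_of_idempotent [Finite V] (r : V → V) (hr : ∀ i, r (r i) = r i)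
    (W : Finset V) (hW : ∀ i ∈ W, r i ≠ i) [DecidableEq V] :
    (W.card : ℕ∞) ≤ (labelIdeal K ∅ (fun i => if i ∈ W then r i else i)).height := by
  induction W using Finset.induction_on with
  | empty => simp
  | insert w W hw ih =>
    refine le_trans ?_ (Ideal.height_add_one_le_of_lt_of_isPrime
      (I := labelIdeal K ∅ (fun i => if i ∈ W then r i else i)) (labelIdeal_lt ?_ ?_))
    · rw [Finset.card_insert_of_notMem hw, Nat.cast_add, Nat.cast_one]
      gcongr
      exact ih fun i hi => hW i (Finset.mem_insert_of_mem hi)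
    · have hw' : r w ≠ w := hW w (Finset.mem_insert_self _ _)
      have hrw (i : V) : r i ≠ w := fun h => hw' (by rw [← h, hr])
      refine labelIdeal_le_labelIdeal_iff.mpr ⟨subset_rfl, fun i _ j _ hij => ?_⟩
      -- The new labelling is the old one followed by `w ↦ r w`; idempotence is what keeps `w` from
      -- being a value of `r`.
      have key (i : V) : (if i ∈ insert w W then r i else i) =
          (fun k => if k = w then r w else k) (if i ∈ W then r i else i) := by
        by_cases h1 : i = w
        · subst h1; simp [hw]
        · by_cases h2 : i ∈ W <;> simp [h1, h2, hrw]
      simp only [key, hij]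
    · have hw' : r w ≠ w := hW w (Finset.mem_insert_self _ _)
      have hrW (i : V) : r i ∉ insert w W := fun h => hW _ h (hr i)
      have hrW' : r w ∉ W := fun h => hrW w (Finset.mem_insert_of_mem h)
      rintro ⟨-, h⟩
      have := h w (by simp) (r w) (by simp) (by simp [hr])
      simp only [hw, hrW', if_false, hr] at this
      exact hw' this.symm

lemma card_add_le_height_labelIdeal [Finite V] (S : Set V) (l : V → V) (T : Finset V)
    (hT : ∀ i ∈ T, i ∉ S) :
    (labelIdeal K S l).height + T.card ≤ (labelIdeal K (S ∪ T) l).height := by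
  classical
  induction T using Finset.induction_on with
  | empty => simp
  | insert w W hw ih =>
    have hlt : labelIdeal K (S ∪ W) l < labelIdeal K (S ∪ (insert w W : Finset V)) l := by
      refine labelIdeal_lt (labelIdeal_mono_left ?_ l) ?_
      · exact Set.union_subset_union_right _ (by simp)
      · rintro ⟨h, -⟩
        have : w ∈ S ∪ (W : Set V) := h (.inr (by simp))
        exact this.elim (hT w (by simp)) (by simpa using hw)
    refine le_trans ?_ (Ideal.height_add_one_le_of_lt_of_isPrime hlt)
    rw [Finset.card_insert_of_notMem hw, Nat.cast_add, Nat.cast_one, ← add_assoc]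
    gcongr
    exact ih fun i hi => hT i (Finset.mem_insert_of_mem hi)

/-- The height of `labelIdeal K S r` when the labels are representatives of the blocks. -/
lemma height_labelIdeal [Finite V] (S : Finset V) (r : V → V)
    (hr : ∀ i, r (r i) = r i) (hS : ∀ i ∈ S, r i = i) (hS' : ∀ i ∉ S, r i ∉ S)
    (hne : ∃ z, z ∉ S) :
    ∃ h : ℕ, (labelIdeal K (S : Set V) r).height = h ∧
      h + Nat.card {i // r i = i} = 2 * S.card + Nat.card V := by
  classical
  have := Fintype.ofFinite V
  -- Two variables for each element of `S`, and one minor with the representative for each element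
  -- that is not its own representative.
  refine ⟨2 * S.card + (Finset.univ.filter fun i => ¬ r i = i).card, ?_, ?_⟩
  swap
  · rw [Nat.card_eq_fintype_card, Nat.card_eq_fintype_card, Fintype.card_subtype,
      ← Finset.card_univ, ← Finset.card_filter_add_card_filter_not (s := Finset.univ)
      (fun i => r i = i)]
    omega
  apply le_antisymm
  · let gens : Finset (EdgeRing K V) := S.image (xVar K) ∪ S.image (yVar K) ∪
      (Finset.univ.filter fun i => ¬ r i = i).image
        fun i => xVar K i * yVar K (r i) - xVar K (r i) * yVar K i
    have hcard : gens.card ≤ 2 * S.card + (Finset.univ.filter fun i => ¬ r i = i).card := by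
      refine (Finset.card_union_le _ _).trans (add_le_add ((Finset.card_union_le _ _).trans ?_)
        Finset.card_image_le)
      rw [two_mul]
      exact add_le_add Finset.card_image_le Finset.card_image_le
    have hmin : labelIdeal K (S : Set V) r ∈ (Ideal.span (gens : Set (EdgeRing K V))).minimalPrimes := by
      refine ⟨⟨inferInstance, ?_⟩, fun Q ⟨hQ, hQg⟩ hQP => ?_⟩
      · rw [Ideal.span_le]
        intro p hp
        simp only [gens, Finset.coe_union, Finset.coe_image, Set.mem_union, Set.mem_image,
          Finset.mem_coe, Finset.mem_filter] at hp
        rcases hp with (⟨i, hi, rfl⟩ | ⟨i, hi, rfl⟩) | ⟨i, hi, rfl⟩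
        · exact xVar_mem_labelIdeal r (by simpa using hi)
        · exact yVar_mem_labelIdeal r (by simpa using hi)
        · exact minor_mem_labelIdeal _ (hr i).symm
      · have hroot (i : V) : xVar K i * yVar K (r i) - xVar K (r i) * yVar K i ∈ Q := by
          by_cases hi : r i = i
          · simp [hi]
          · refine hQg (Ideal.subset_span ?_)
            simp only [gens, Finset.coe_union, Finset.coe_image]
            exact .inr ⟨i, by simp [hi], rfl⟩
        have hvar (i : V) (hi : i ∈ S) : xVar K i ∈ Q ∧ yVar K i ∈ Q := by
          refine ⟨hQg (Ideal.subset_span ?_), hQg (Ideal.subset_span ?_)⟩ <;>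
            simp only [gens, Finset.coe_union, Finset.coe_image]
          · exact .inl (.inl ⟨i, hi, rfl⟩)
          · exact .inl (.inr ⟨i, hi, rfl⟩)
        refine labelIdeal_le.mpr ⟨fun i hi => hvar i hi, fun i j hij => ?_⟩
        by_cases hi : i ∈ S
        · exact sub_mem (Ideal.mul_mem_right _ _ (hvar i hi).1)
            (Ideal.mul_mem_left _ _ (hvar i hi).2)
        -- Minimality: `Q` lies below the label ideal, so it misses the variable of a representative
        -- outside `S`. Cancelling that variable recovers every minor of the block from the minors
        -- with the representative.
        · have hx : xVar K (r i) ∉ Q := fun h =>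
            xVar_notMem_labelIdeal (l := r) (S := (S : Set V)) (by simpa using hS' i hi) (hQP h)
          refine (hQ.mem_or_mem ?_).resolve_left hx
          have h1 := hroot i
          have h2 := hroot j
          rw [← hij] at h2
          have : xVar K (r i) * (xVar K i * yVar K j - xVar K j * yVar K i) =
              xVar K j * (xVar K i * yVar K (r i) - xVar K (r i) * yVar K i) -
              xVar K i * (xVar K j * yVar K (r i) - xVar K (r i) * yVar K j) := by ring
          rw [this]
          exact sub_mem (Ideal.mul_mem_left _ _ h1) (Ideal.mul_mem_left _ _ h2)
    exact (Ideal.height_le_card_of_mem_minimalPrimes_span_finset hmin).trans (by exact_mod_cast hcard)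
  · obtain ⟨z, hz⟩ := hne
    -- Putting a vertex of `S` into the set of killed columns lengthens the chain by only one, but
    -- it has to contribute two to the height. The other step comes from first merging it into the
    -- block of `z ∉ S`.
    let r' (i : V) : V := if i ∈ S then r z else r i
    have hr' (i : V) : r' (r' i) = r' i := by
      have := hS' z hz
      by_cases hi : i ∈ S
      · simp [r', hi, this, hr]
      · simp [r', hi, hS' i hi, hr]
    let W := Finset.univ.filter fun i => r' i ≠ i
    have hW : W = S ∪ Finset.univ.filter fun i => ¬ r i = i := by
      ext i
      have := hS' z hz
      by_cases hi : i ∈ S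
      · have h : r z ≠ i := fun h => this (h ▸ hi)
        simp [W, r', hi, h]
      · simp [W, r', hi]
    have hWcard : W.card = S.card + (Finset.univ.filter fun i => ¬ r i = i).card := by
      rw [hW, Finset.card_union_of_disjoint]
      exact Finset.disjoint_left.mpr fun i hi h => by simp [hS i hi] at h
    have h1 := card_le_height_labelIdeal_of_idempotent (K := K) r' hr' W (by simp [W])
    have hfun : (fun i => if i ∈ W then r' i else i) = r' := by
      ext i
      by_cases hi : r' i = i <;> simp [W, hi]
    rw [hfun] at h1
    have h2 := card_add_le_height_labelIdeal (K := K) ∅ r' S (by simp)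
    have h3 : labelIdeal K (∅ ∪ (S : Set V)) r' ≤ labelIdeal K (S : Set V) r := by
      refine labelIdeal_le_labelIdeal_iff.mpr ⟨by simp, fun i hi j hj hij => ?_⟩
      have hi' : i ∉ S := by simpa using hi
      have hj' : j ∉ S := by simpa using hj
      simpa [r', hi', hj'] using hij
    refine le_trans ?_ (Ideal.height_mono h3)
    refine le_trans ?_ h2
    refine le_trans ?_ (add_le_add_left h1 _)
    norm_cast
    omega

end Height

/-! ### Components after deleting a vertex set. -/

namespace SimpleGraph

variable {V : Type*}

/-- The graph obtained from `G` by deleting all edges that meet `S`. -/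
def avoid (G : SimpleGraph V) (S : Set V) : SimpleGraph V where
  Adj a b := G.Adj a b ∧ a ∉ S ∧ b ∉ S
  symm := ⟨fun _ _ ⟨h, ha, hb⟩ => ⟨h.symm, hb, ha⟩⟩
  loopless := ⟨fun _ h => h.1.ne rfl⟩

@[simp] lemma avoid_adj {G : SimpleGraph V} {S : Set V} {a b : V} :
    (G.avoid S).Adj a b ↔ G.Adj a b ∧ a ∉ S ∧ b ∉ S := Iff.rfl

@[simp] lemma avoid_empty (G : SimpleGraph V) : G.avoid ∅ = G := by
  ext; simp

lemma avoid_anti (G : SimpleGraph V) {S T : Set V} (h : S ⊆ T) : G.avoid T ≤ G.avoid S :=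
  fun _ _ hab => ⟨hab.1, fun ha => hab.2.1 (h ha), fun hb => hab.2.2 (h hb)⟩

/-- A function that is constant along edges is constant on connected components. -/
lemma Reachable.eq_of_forall_adj {ι : Type*} {G : SimpleGraph V} {l : V → ι}
    (h : ∀ a b, G.Adj a b → l a = l b) {a b : V} (hab : G.Reachable a b) : l a = l b := by
  obtain ⟨w⟩ := hab
  induction w with
  | nil => rfl
  | cons hadj _ ih => exact (h _ _ hadj).trans ih

/-- A relation that contains the adjacency relation and is reflexive and transitive contains the
reachability relation. -/
lemma Reachable.rel_of_forall_adj {G : SimpleGraph V} {R : V → V → Prop} (hrefl : ∀ a, R a a)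
    (htrans : ∀ a b c, G.Adj a b → R b c → R a c) {a b : V} (hab : G.Reachable a b) : R a b := by
  obtain ⟨w⟩ := hab
  induction w with
  | nil => exact hrefl _
  | cons hadj _ ih => exact htrans _ _ _ hadj ih

lemma not_reachable_avoid {G : SimpleGraph V} {S : Set V} {a b : V} (ha : a ∈ S) (hab : a ≠ b) :
    ¬ (G.avoid S).Reachable a b := by
  intro h
  refine hab ?_
  have := h.rel_of_forall_adj (G := G.avoid S) (R := fun x y => x ∈ S → x = y) (fun _ _ => rfl)
    (fun x y z hxy _ hx => absurd hx hxy.2.1)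
  exact this ha

lemma reachable_induce_compl_iff {G : SimpleGraph V} {S : Set V} {a b : V} (ha : a ∈ Sᶜ)
    (hb : b ∈ Sᶜ) :
    (G.induce Sᶜ).Reachable ⟨a, ha⟩ ⟨b, hb⟩ ↔ (G.avoid S).Reachable a b := by
  constructor
  · intro h
    let f : G.induce Sᶜ →g G.avoid S :=
      { toFun := Subtype.val, map_rel' := @fun x y (hxy : G.Adj x y) => ⟨hxy, x.2, y.2⟩ }
    exact h.map f
  · intro h
    have := h.rel_of_forall_adj (R := fun x y => ∀ (hx : x ∈ Sᶜ) (hy : y ∈ Sᶜ),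
      (G.induce Sᶜ).Reachable ⟨x, hx⟩ ⟨y, hy⟩) (fun _ _ _ => .rfl)
      (fun x y z hxy hyz hx hz => by
        have hadj : (G.induce Sᶜ).Adj ⟨x, hx⟩ ⟨y, hxy.2.2⟩ := hxy.1
        exact hadj.reachable.trans (hyz hxy.2.2 hz))
    exact this ha hb

/-- `i` has two neighbours outside `S` that are separated by `S`. -/
def CutAt (G : SimpleGraph V) (S : Set V) (i : V) : Prop :=
  ∃ a b, G.Adj i a ∧ G.Adj i b ∧ a ∉ S ∧ b ∉ S ∧ ¬ (G.avoid S).Reachable a b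

/-- If `i` does not join two components of `G - S`, then removing `i` from `S` does not change the
components. -/
lemma reachable_avoid_diff_singleton {G : SimpleGraph V} {S : Set V} {i : V}
    (hi : ¬ G.CutAt S i) {a b : V} (ha : a ∉ S) (hb : b ∉ S)
    (h : (G.avoid (S \ {i})).Reachable a b) : (G.avoid S).Reachable a b := by
  have hcut : ∀ a b, G.Adj i a → G.Adj i b → a ∉ S → b ∉ S → (G.avoid S).Reachable a b := by
    intro a b h1 h2 h3 h4
    by_contra h5
    exact hi ⟨a, b, h1, h2, h3, h4, h5⟩
  by_cases hiS : i ∈ S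
  · have hS {x : V} (hx : x ∉ S \ {i}) (hxi : x ≠ i) : x ∉ S := fun h => hx ⟨h, hxi⟩
    -- A walk through `i` is rerouted by induction along it. The stand-in `z` for the current vertex
    -- is the vertex itself, or, when the walk is at `i`, any neighbour of `i` outside `S`; all such
    -- neighbours lie in one component.
    have := h.rel_of_forall_adj
      (R := fun x y => y ∉ S → ∀ z, z ∉ S → ((x ≠ i ∧ z = x) ∨ (x = i ∧ G.Adj i z)) →
        (G.avoid S).Reachable z y)
      (fun x hx z hz hxz => by
        rcases hxz with ⟨-, rfl⟩ | ⟨rfl, -⟩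
        · exact .rfl
        · exact absurd hiS hx)
      (fun x y w hxy ih hw z hz hxz => by
        obtain ⟨hadj, hx, hy⟩ := hxy
        rcases hxz with ⟨hxi, rfl⟩ | ⟨rfl, hz'⟩
        · by_cases hyi : y = i
          · subst hyi
            exact ih hw z hz (.inr ⟨rfl, hadj.symm⟩)
          · exact (Adj.reachable (G := G.avoid S) ⟨hadj, hz, hS hy hyi⟩).trans
              (ih hw y (hS hy hyi) (.inl ⟨hyi, rfl⟩))
        · have hyi : y ≠ x := hadj.ne'
          exact (hcut z y hz' hadj hz (hS hy hyi)).trans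
            (ih hw y (hS hy hyi) (.inl ⟨hyi, rfl⟩)))
    exact this hb a ha (.inl ⟨fun h => ha (h ▸ hiS), rfl⟩)
  · rwa [Set.sdiff_singleton_eq_self hiS] at h

end SimpleGraph

/-! ### Minimal primes, cut sets and unmixedness in combinatorial terms. -/

section CutSets

variable {K : Type*} {V : Type*} [Field K]

/-- The freedom in `l` is used twice: labels by components serve for primality and inclusions,
labels by representative vertices for the height. -/
lemma cutIdeal_eq_labelIdeal {ι : Type*} (G : SimpleGraph V) (S : Set V) (l : V → ι)
    (hl : ∀ i ∉ S, ∀ j ∉ S, l i = l j ↔ (G.avoid S).Reachable i j) :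
    cutIdeal K G S = labelIdeal K S l := by
  apply le_antisymm
  · refine sup_le (Ideal.span_le.mpr ?_) (Ideal.span_le.mpr ?_)
    · rintro p ⟨i, hi, rfl | rfl⟩
      exacts [xVar_mem_labelIdeal l hi, yVar_mem_labelIdeal l hi]
    · rintro p ⟨i, j, ⟨-, hi, hj, h⟩, rfl⟩
      exact minor_mem_labelIdeal S
        ((hl i hi j hj).mpr ((SimpleGraph.reachable_induce_compl_iff hi hj).mp h))
  · have hx (i : V) (hi : i ∈ S) : xVar K i ∈ cutIdeal K G S :=
      Ideal.mem_sup_left (Ideal.subset_span ⟨i, hi, .inl rfl⟩)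
    have hy (i : V) (hi : i ∈ S) : yVar K i ∈ cutIdeal K G S :=
      Ideal.mem_sup_left (Ideal.subset_span ⟨i, hi, .inr rfl⟩)
    refine labelIdeal_le.mpr ⟨fun i hi => ⟨hx i hi, hy i hi⟩, fun i j hij => ?_⟩
    by_cases hi : i ∈ S
    · exact sub_mem (Ideal.mul_mem_right _ _ (hx i hi)) (Ideal.mul_mem_left _ _ (hy i hi))
    by_cases hj : j ∈ S
    · exact sub_mem (Ideal.mul_mem_left _ _ (hy j hj)) (Ideal.mul_mem_right _ _ (hx j hj))
    by_cases h : i = j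
    · subst h; simp
    exact Ideal.mem_sup_right (Ideal.subset_span ⟨i, j, ⟨h, hi, hj,
      (SimpleGraph.reachable_induce_compl_iff hi hj).mpr ((hl i hi j hj).mp hij)⟩, rfl⟩)

lemma cutIdeal_eq_labelIdeal_connectedComponentMk (G : SimpleGraph V) (S : Set V) :
    cutIdeal K G S = labelIdeal K S (G.avoid S).connectedComponentMk :=
  cutIdeal_eq_labelIdeal G S _ fun _ _ _ _ => SimpleGraph.ConnectedComponent.eq

instance cutIdeal_isPrime [Finite V] (G : SimpleGraph V) (S : Set V) :
    (cutIdeal K G S).IsPrime := by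
  rw [cutIdeal_eq_labelIdeal_connectedComponentMk]
  infer_instance

lemma cutIdeal_le_cutIdeal_iff {G : SimpleGraph V} {S T : Set V} :
    cutIdeal K G S ≤ cutIdeal K G T ↔ S ⊆ T ∧
      ∀ i ∉ T, ∀ j ∉ T, (G.avoid S).Reachable i j → (G.avoid T).Reachable i j := by
  rw [cutIdeal_eq_labelIdeal_connectedComponentMk, cutIdeal_eq_labelIdeal_connectedComponentMk,
    labelIdeal_le_labelIdeal_iff]
  simp only [SimpleGraph.ConnectedComponent.eq]

lemma binomialEdgeIdeal_le_cutIdeal (G : SimpleGraph V) (S : Set V) :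
    binomialEdgeIdeal K G ≤ cutIdeal K G S := by
  rw [cutIdeal_eq_labelIdeal_connectedComponentMk]
  refine Ideal.span_le.mpr ?_
  rintro p ⟨i, j, hij, rfl⟩
  by_cases hi : i ∈ S
  · exact sub_mem (Ideal.mul_mem_right _ _ (xVar_mem_labelIdeal _ hi))
      (Ideal.mul_mem_left _ _ (yVar_mem_labelIdeal _ hi))
  by_cases hj : j ∈ S
  · exact sub_mem (Ideal.mul_mem_left _ _ (yVar_mem_labelIdeal _ hj))
      (Ideal.mul_mem_right _ _ (xVar_mem_labelIdeal _ hj))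
  exact minor_mem_labelIdeal S (SimpleGraph.ConnectedComponent.eq.mpr
    (SimpleGraph.Adj.reachable ⟨hij, hi, hj⟩))

/-- Take for $S$ the vertices with both variables in `Q`. A vertex outside $S$ has a variable that
can be cancelled modulo the prime `Q`, so membership of minors in `Q` is transitive along walks that
avoid $S$. -/
lemma exists_cutIdeal_le (G : SimpleGraph V) {Q : Ideal (EdgeRing K V)} [hQ : Q.IsPrime]
    (h : binomialEdgeIdeal K G ≤ Q) : ∃ S, cutIdeal K G S ≤ Q := by
  let S : Set V := {i | xVar K i ∈ Q ∧ yVar K i ∈ Q}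
  refine ⟨S, ?_⟩
  rw [cutIdeal_eq_labelIdeal_connectedComponentMk]
  refine labelIdeal_le.mpr ⟨fun i hi => hi, fun i j hij => ?_⟩
  refine (SimpleGraph.ConnectedComponent.eq.mp hij).rel_of_forall_adj
    (R := fun i j => xVar K i * yVar K j - xVar K j * yVar K i ∈ Q) (fun i => by simp) ?_
  rintro i k j ⟨hik, -, hk⟩ hkj
  have h1 : xVar K i * yVar K k - xVar K k * yVar K i ∈ Q :=
    h (Ideal.subset_span ⟨i, k, hik, rfl⟩)
  by_cases hx : xVar K k ∈ Q
  · have hy : yVar K k ∉ Q := fun hy => hk ⟨hx, hy⟩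
    refine (hQ.mem_or_mem ?_).resolve_left hy
    have e : yVar K k * (xVar K i * yVar K j - xVar K j * yVar K i) =
      yVar K j * (xVar K i * yVar K k - xVar K k * yVar K i) +
      yVar K i * (xVar K k * yVar K j - xVar K j * yVar K k) := by ring
    rw [e]
    exact add_mem (Ideal.mul_mem_left _ _ h1) (Ideal.mul_mem_left _ _ hkj)
  · refine (hQ.mem_or_mem ?_).resolve_left hx
    have e : xVar K k * (xVar K i * yVar K j - xVar K j * yVar K i) =
      xVar K j * (xVar K i * yVar K k - xVar K k * yVar K i) +
      xVar K i * (xVar K k * yVar K j - xVar K j * yVar K k) := by ring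
    rw [e]
    exact add_mem (Ideal.mul_mem_left _ _ h1) (Ideal.mul_mem_left _ _ hkj)

/-- Every minimal prime of a binomial edge ideal is `P_S(G)` for a cut set `S`. -/
lemma mem_minimalPrimes_binomialEdgeIdeal [Finite V] (G : SimpleGraph V)
    {Q : Ideal (EdgeRing K V)} :
    Q ∈ (binomialEdgeIdeal K G).minimalPrimes ↔ ∃ S ∈ cutSets K G, Q = cutIdeal K G S := by
  refine ⟨fun hQ => ?_, ?_⟩
  · have := hQ.1.1
    obtain ⟨S, hS⟩ := exists_cutIdeal_le G hQ.1.2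
    have e : Q = cutIdeal K G S :=
      le_antisymm (hQ.2 ⟨inferInstance, binomialEdgeIdeal_le_cutIdeal G S⟩ hS) hS
    refine ⟨S, ?_, e⟩
    rw [e] at hQ
    exact hQ
  · rintro ⟨S, hS, rfl⟩
    exact hS

/-- A set `S` is a cut set iff every element of `S` joins two components of `G - S`. -/
lemma mem_cutSets_iff [Finite V] (G : SimpleGraph V) (S : Set V) :
    S ∈ cutSets K G ↔ ∀ i ∈ S, G.CutAt S i := by
  constructor
  · intro hS i hi
    by_contra hcut
    -- A vertex of `S` that joins no two components can be dropped, which yields a smaller prime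
    -- over the edge ideal.
    have hle : cutIdeal K G (S \ {i}) ≤ cutIdeal K G S :=
      cutIdeal_le_cutIdeal_iff.mpr ⟨Set.sdiff_subset,
        fun a ha b hb h => SimpleGraph.reachable_avoid_diff_singleton hcut ha hb h⟩
    have := hS.2 ⟨inferInstance, binomialEdgeIdeal_le_cutIdeal G _⟩ hle
    exact ((cutIdeal_le_cutIdeal_iff.mp this).1 hi).2 rfl
  · intro hS
    refine ⟨⟨inferInstance, binomialEdgeIdeal_le_cutIdeal G S⟩, fun Q ⟨hQ, hQJ⟩ hle => ?_⟩
    obtain ⟨T, hT⟩ := exists_cutIdeal_le G hQJ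
    obtain ⟨hTS, hreach⟩ := cutIdeal_le_cutIdeal_iff.mp (hT.trans hle)
    -- If `T` missed some `i ∈ S`, two neighbours of `i` separated by `S` would be joined through
    -- `i` in $G-T$, against `hreach`.
    have : T = S := by
      refine Set.Subset.antisymm hTS fun i hi => ?_
      by_contra hiT
      obtain ⟨a, b, hia, hib, ha, hb, hab⟩ := hS i hi
      refine hab (hreach a ha b hb ?_)
      exact (SimpleGraph.Adj.reachable (G := G.avoid T) ⟨hia.symm, fun h => ha (hTS h), hiT⟩).trans
        (SimpleGraph.Adj.reachable (G := G.avoid T) ⟨hib, hiT, fun h => hb (hTS h)⟩)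
    exact this ▸ hT

lemma empty_mem_cutSets [Finite V] (G : SimpleGraph V) : ∅ ∈ cutSets K G := by
  simp [mem_cutSets_iff]

lemma exists_notMem_of_mem_cutSets [Finite V] [Nonempty V] {G : SimpleGraph V} {S : Set V}
    (hS : S ∈ cutSets K G) : ∃ z, z ∉ S := by
  by_contra! h
  obtain ⟨z⟩ := ‹Nonempty V›
  obtain ⟨a, -, -, -, ha, -⟩ := (mem_cutSets_iff G S).mp hS z (h z)
  exact ha (h a)

/-- The number of components of `G - S`, each element of `S` counting as a component too. -/
noncomputable def SimpleGraph.avoidComponents (G : SimpleGraph V) (S : Set V) : ℕ :=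
  Nat.card (G.avoid S).ConnectedComponent

lemma SimpleGraph.Connected.avoidComponents_empty {H : SimpleGraph V} (hH : H.Connected) :
    H.avoidComponents ∅ = 1 := by
  rw [SimpleGraph.avoidComponents, SimpleGraph.avoid_empty, Nat.card_eq_one_iff_unique]
  exact ⟨hH.preconnected.subsingleton_connectedComponent,
    ⟨H.connectedComponentMk hH.nonempty.some⟩⟩

/-- The height of `P_S(G)`. -/
lemma height_cutIdeal [Finite V] (G : SimpleGraph V) (S : Set V) (hS : ∃ z, z ∉ S) :
    ∃ h : ℕ, (cutIdeal K G S).height = h ∧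
      h + G.avoidComponents S = 2 * S.ncard + Nat.card V := by
  classical
  have := Fintype.ofFinite V
  let r (i : V) : V := ((G.avoid S).connectedComponentMk i).out
  have hreach (i : V) : (G.avoid S).Reachable (r i) i :=
    SimpleGraph.ConnectedComponent.eq.mp (Quot.out_eq _)
  have hri (i j : V) : r i = r j ↔ (G.avoid S).Reachable i j := by
    refine ⟨fun h => (hreach i).symm.trans (h ▸ hreach j), fun h => ?_⟩
    simp only [r, SimpleGraph.ConnectedComponent.eq.mpr h]
  have hrS (i : V) (hi : i ∈ S) : r i = i := by
    by_contra h
    exact SimpleGraph.not_reachable_avoid hi (Ne.symm h) (hreach i).symm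
  have hrS' (i : V) (hi : i ∉ S) : r i ∉ S := fun h =>
    SimpleGraph.not_reachable_avoid h (fun e => hi (by rwa [e] at h)) (hreach i)
  obtain ⟨h, hh, hh'⟩ := height_labelIdeal (K := K) S.toFinset r
    (fun i => (hri _ _).mpr (hreach i)) (fun i hi => hrS i (by simpa using hi))
    (fun i hi => by simpa using hrS' i (by simpa using hi)) (by simpa using hS)
  rw [Set.coe_toFinset, ← cutIdeal_eq_labelIdeal G S r fun i _ j _ => hri i j] at hh
  rw [← Set.ncard_eq_toFinset_card'] at hh'
  refine ⟨h, hh, ?_⟩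
  rw [← hh', SimpleGraph.avoidComponents]
  congr 1
  refine Nat.card_congr ⟨fun c => ⟨c.out, ?_⟩, fun i => (G.avoid S).connectedComponentMk i,
    fun c => Quot.out_eq c, fun i => Subtype.ext i.2⟩
  exact congrArg Quot.out (Quot.out_eq c)

/-- For a connected graph, unmixedness means that `G - S` has `|S| + 1` components for all cut
sets `S`. -/
lemma isUnmixed_iff [Finite V] {G : SimpleGraph V} (hG : G.Connected) :
    (binomialEdgeIdeal K G).IsUnmixed ↔
      ∀ S ∈ cutSets K G, G.avoidComponents S = 2 * S.ncard + 1 := by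
  have := hG.nonempty
  have h0 := hG.avoidComponents_empty
  -- The empty set is always a cut set, so $|V|-1$ is the reference height. The value `2 * S.ncard +
  -- 1` means $|S|+1$ genuine components, as `avoidComponents` also counts the $|S|$ isolated
  -- removed vertices.
  obtain ⟨n, hn, hn'⟩ := height_cutIdeal (K := K) G ∅ (by simp)
  rw [h0, Set.ncard_empty] at hn'
  constructor
  · intro h S hS
    obtain ⟨m, hm, hm'⟩ := height_cutIdeal (K := K) G S (exists_notMem_of_mem_cutSets hS)
    have := h _ hS _ (empty_mem_cutSets G)
    rw [hm, hn, Nat.cast_inj] at this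
    omega
  · intro h
    have key : ∀ P ∈ (binomialEdgeIdeal K G).minimalPrimes, P.height = n := by
      intro P hP
      obtain ⟨S, hS, rfl⟩ := (mem_minimalPrimes_binomialEdgeIdeal G).mp hP
      obtain ⟨m, hm, hm'⟩ := height_cutIdeal (K := K) G S (exists_notMem_of_mem_cutSets hS)
      have := h S hS
      rw [hm, Nat.cast_inj]
      omega
    intro P hP Q hQ
    rw [key P hP, key Q hQ]

end CutSets

/-! ### Wedges of two graphs at a vertex. -/

namespace SimpleGraph

variable {V V₁ V₂ : Type*}

/-- `H` is obtained from `H₁` and `H₂` by identifying the vertices `v₁` and `v₂`. -/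
structure IsWedge (H₁ : SimpleGraph V₁) (H₂ : SimpleGraph V₂) (H : SimpleGraph V)
    (p : V₁ → V) (q : V₂ → V) (v₁ : V₁) (v₂ : V₂) : Prop where
  inj_left : p.Injective
  inj_right : q.Injective
  cover : ∀ x, (∃ a, p a = x) ∨ ∃ b, q b = x
  eq_iff : ∀ a b, p a = q b ↔ a = v₁ ∧ b = v₂
  adj_left : ∀ a a', H.Adj (p a) (p a') ↔ H₁.Adj a a'
  adj_right : ∀ b b', H.Adj (q b) (q b') ↔ H₂.Adj b b'
  adj_cross : ∀ a b, H.Adj (p a) (q b) → a = v₁ ∨ b = v₂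

namespace IsWedge

variable {H₁ : SimpleGraph V₁} {H₂ : SimpleGraph V₂} {H : SimpleGraph V}
  {p : V₁ → V} {q : V₂ → V} {v₁ : V₁} {v₂ : V₂}

lemma symm (h : IsWedge H₁ H₂ H p q v₁ v₂) : IsWedge H₂ H₁ H q p v₂ v₁ where
  inj_left := h.inj_right
  inj_right := h.inj_left
  cover x := (h.cover x).symm
  eq_iff a b := by rw [eq_comm, h.eq_iff, and_comm]
  adj_left := h.adj_right
  adj_right := h.adj_left
  adj_cross a b hab := (h.adj_cross b a hab.symm).symm

lemma point (h : IsWedge H₁ H₂ H p q v₁ v₂) : p v₁ = q v₂ := (h.eq_iff _ _).mpr ⟨rfl, rfl⟩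

lemma avoid (h : IsWedge H₁ H₂ H p q v₁ v₂) (S : Set V) :
    IsWedge (H₁.avoid (p ⁻¹' S)) (H₂.avoid (q ⁻¹' S)) (H.avoid S) p q v₁ v₂ where
  inj_left := h.inj_left
  inj_right := h.inj_right
  cover := h.cover
  eq_iff := h.eq_iff
  adj_left a a' := by simp [h.adj_left]
  adj_right a a' := by simp [h.adj_right]
  adj_cross a b hab := h.adj_cross a b hab.1

/-- Collapse the whole second side to the common vertex. An edge goes to an edge or to a single
vertex, so walks in the wedge project to walks in one side. -/
lemma exists_retraction (h : IsWedge H₁ H₂ H p q v₁ v₂) :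
    ∃ r : V → V₁, (∀ a, r (p a) = a) ∧ (∀ b, r (q b) = v₁) ∧
      ∀ x y, H.Adj x y → r x = r y ∨ H₁.Adj (r x) (r y) := by
  classical
  let r (x : V) : V₁ := if hx : ∃ a, p a = x then hx.choose else v₁
  have hp (a : V₁) : r (p a) = a := by
    have hx : ∃ a', p a' = p a := ⟨a, rfl⟩
    simp only [r, dif_pos hx]
    exact h.inj_left hx.choose_spec
  have hq (b : V₂) : r (q b) = v₁ := by
    by_cases hx : ∃ a, p a = q b
    · simp only [r, dif_pos hx]
      exact ((h.eq_iff _ _).mp hx.choose_spec).1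
    · simp only [r, dif_neg hx]
  refine ⟨r, hp, hq, fun x y hxy => ?_⟩
  have key (a : V₁) (b : V₂) (hab : H.Adj (p a) (q b)) : a = v₁ ∨ H₁.Adj a v₁ := by
    rcases h.adj_cross _ _ hab with rfl | rfl
    · exact .inl rfl
    · rw [← h.point, h.adj_left] at hab
      exact .inr hab
  rcases h.cover x with ⟨a, rfl⟩ | ⟨b, rfl⟩ <;> rcases h.cover y with ⟨a', rfl⟩ | ⟨b', rfl⟩ <;>
    simp only [hp, hq]
  · exact .inr ((h.adj_left _ _).mp hxy)
  · exact key _ _ hxy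
  · exact (key _ _ hxy.symm).imp Eq.symm Adj.symm
  · exact .inl trivial

lemma reachable_retraction {r : V → V₁} (hr : ∀ x y, H.Adj x y → r x = r y ∨ H₁.Adj (r x) (r y))
    {x y : V} (hxy : H.Reachable x y) : H₁.Reachable (r x) (r y) :=
  hxy.rel_of_forall_adj (R := fun x y => H₁.Reachable (r x) (r y)) (fun _ => .rfl)
    (fun x y z hadj hyz => by
      rcases hr x y hadj with e | hadj'
      · rwa [e]
      · exact hadj'.reachable.trans hyz)

lemma reachable_left (h : IsWedge H₁ H₂ H p q v₁ v₂) {a a' : V₁} :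
    H.Reachable (p a) (p a') ↔ H₁.Reachable a a' := by
  obtain ⟨r, hp, -, hr⟩ := h.exists_retraction
  refine ⟨fun hab => ?_, fun hab => ?_⟩
  · simpa only [hp] using reachable_retraction hr hab
  · exact hab.rel_of_forall_adj (R := fun x y => H.Reachable (p x) (p y)) (fun _ => .rfl)
      (fun x y z hxy hyz => ((h.adj_left _ _).mpr hxy).reachable.trans hyz)

lemma reachable_right (h : IsWedge H₁ H₂ H p q v₁ v₂) {b b' : V₂} :
    H.Reachable (q b) (q b') ↔ H₂.Reachable b b' := h.symm.reachable_left

lemma reachable_cross (h : IsWedge H₁ H₂ H p q v₁ v₂) {a : V₁} {b : V₂} :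
    H.Reachable (p a) (q b) ↔ H₁.Reachable a v₁ ∧ H₂.Reachable v₂ b := by
  refine ⟨fun hab => ⟨?_, ?_⟩, fun ⟨h1, h2⟩ => ?_⟩
  · obtain ⟨r, hp, hq, hr⟩ := h.exists_retraction
    simpa only [hp, hq] using reachable_retraction hr hab
  · obtain ⟨r, hp, hq, hr⟩ := h.symm.exists_retraction
    simpa only [hp, hq] using reachable_retraction hr hab
  · have h1' := h.reachable_left.mpr h1
    rw [h.point] at h1'
    exact h1'.trans (h.reachable_right.mpr h2)

/-- Components of the wedge are those of the left side together with those of the right side not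
containing `v₂`; the component of the common vertex is counted twice on the right-hand side. -/
lemma card_connectedComponent [Finite V₁] [Finite V₂] (h : IsWedge H₁ H₂ H p q v₁ v₂) :
    Nat.card H.ConnectedComponent + 1 =
      Nat.card H₁.ConnectedComponent + Nat.card H₂.ConnectedComponent := by
  classical
  let f : H₁ →g H := { toFun := p, map_rel' := fun {a b} hab => (h.adj_left a b).mpr hab }
  let g : H₂ →g H := { toFun := q, map_rel' := fun {a b} hab => (h.adj_right a b).mpr hab }
  let F : H₁.ConnectedComponent ⊕ {c : H₂.ConnectedComponent // c ≠ H₂.connectedComponentMk v₂} →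
      H.ConnectedComponent := Sum.elim (fun c => c.map f) (fun c => c.1.map g)
  have hcross (a : V₁) (b : V₂) (hb : H₂.connectedComponentMk b ≠ H₂.connectedComponentMk v₂) :
      ¬ H.Reachable (p a) (q b) := fun hab =>
    hb (ConnectedComponent.eq.mpr (h.reachable_cross.mp hab).2.symm)
  have hF : F.Bijective := by
    constructor
    · rintro (c | ⟨c, hc⟩) (d | ⟨d, hd⟩) hcd <;> induction c using ConnectedComponent.ind <;>
        induction d using ConnectedComponent.ind <;>
        simp only [F, Sum.elim_inl, Sum.elim_inr, ConnectedComponent.map_mk,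
          ConnectedComponent.eq] at hcd
      · exact congrArg Sum.inl (ConnectedComponent.eq.mpr (h.reachable_left.mp hcd))
      · exact absurd hcd (hcross _ _ hd)
      · exact absurd hcd.symm (hcross _ _ hc)
      · exact congrArg Sum.inr (Subtype.ext (ConnectedComponent.eq.mpr (h.reachable_right.mp hcd)))
    · intro c
      induction c using ConnectedComponent.ind with
      | h x =>
        rcases h.cover x with ⟨a, rfl⟩ | ⟨b, rfl⟩
        · exact ⟨.inl (H₁.connectedComponentMk a), rfl⟩
        · by_cases hb : H₂.connectedComponentMk b = H₂.connectedComponentMk v₂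
          · refine ⟨.inl (H₁.connectedComponentMk v₁), ConnectedComponent.eq.mpr ?_⟩
            exact h.reachable_cross.mpr ⟨.rfl, (ConnectedComponent.eq.mp hb).symm⟩
          · exact ⟨.inr ⟨H₂.connectedComponentMk b, hb⟩, rfl⟩
  rw [← Nat.card_congr (Equiv.ofBijective F hF), Nat.card_sum, add_assoc, ← Finite.card_option,
    Nat.card_congr (Equiv.optionSubtypeNe _)]

lemma cutAt_left (h : IsWedge H₁ H₂ H p q v₁ v₂) {S : Set V} {a : V₁} (ha : a ≠ v₁) :
    H.CutAt S (p a) ↔ H₁.CutAt (p ⁻¹' S) a := by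
  have hnb (x : V) (hx : H.Adj (p a) x) : ∃ a', p a' = x := by
    rcases h.cover x with hx' | ⟨b, rfl⟩
    · exact hx'
    · rcases h.adj_cross _ _ hx with rfl | rfl
      · exact absurd rfl ha
      · exact ⟨v₁, h.point⟩
  constructor
  · rintro ⟨x, y, hx, hy, hxS, hyS, hxy⟩
    obtain ⟨b, rfl⟩ := hnb x hx
    obtain ⟨c, rfl⟩ := hnb y hy
    exact ⟨b, c, (h.adj_left _ _).mp hx, (h.adj_left _ _).mp hy, hxS, hyS,
      fun hbc => hxy ((h.avoid S).reachable_left.mpr hbc)⟩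
  · rintro ⟨b, c, hb, hc, hbS, hcS, hbc⟩
    exact ⟨p b, p c, (h.adj_left _ _).mpr hb, (h.adj_left _ _).mpr hc, hbS, hcS,
      fun hxy => hbc ((h.avoid S).reachable_left.mp hxy)⟩

lemma cutAt_right (h : IsWedge H₁ H₂ H p q v₁ v₂) {S : Set V} {b : V₂} (hb : b ≠ v₂) :
    H.CutAt S (q b) ↔ H₂.CutAt (q ⁻¹' S) b := h.symm.cutAt_left hb

lemma cutAt_of_cutAt_left (h : IsWedge H₁ H₂ H p q v₁ v₂) {S : Set V} {a : V₁}
    (ha : H₁.CutAt (p ⁻¹' S) a) : H.CutAt S (p a) := by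
  obtain ⟨b, c, hb, hc, hbS, hcS, hbc⟩ := ha
  exact ⟨p b, p c, (h.adj_left _ _).mpr hb, (h.adj_left _ _).mpr hc, hbS, hcS,
    fun hxy => hbc ((h.avoid S).reachable_left.mp hxy)⟩

/-- Once the common vertex is removed the two sides are separated, so one surviving neighbour on
each side suffices. -/
lemma cutAt_point (h : IsWedge H₁ H₂ H p q v₁ v₂) {S : Set V} (hv : p v₁ ∈ S) {a : V₁} {b : V₂}
    (ha : H₁.Adj v₁ a) (hb : H₂.Adj v₂ b) (haS : p a ∉ S) (hbS : q b ∉ S) :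
    H.CutAt S (p v₁) := by
  refine ⟨p a, q b, (h.adj_left _ _).mpr ha, ?_, haS, hbS, fun hab => ?_⟩
  · rw [h.point]
    exact (h.adj_right _ _).mpr hb
  · exact not_reachable_avoid (S := p ⁻¹' S) hv ha.ne ((h.avoid S).reachable_cross.mp hab).1.symm

lemma preimage_left (h : IsWedge H₁ H₂ H p q v₁ v₂) {S₁ : Set V₁} {S₂ : Set V₂}
    (hv : v₁ ∈ S₁ ↔ v₂ ∈ S₂) : p ⁻¹' (p '' S₁ ∪ q '' S₂) = S₁ := by
  ext a
  constructor
  · rintro (⟨a', ha', e⟩ | ⟨b, hb, e⟩)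
    · rwa [← h.inj_left e]
    · obtain ⟨rfl, rfl⟩ := (h.eq_iff _ _).mp e.symm
      exact hv.mpr hb
  · exact fun ha => .inl ⟨a, ha, rfl⟩

lemma preimage_right (h : IsWedge H₁ H₂ H p q v₁ v₂) {S₁ : Set V₁} {S₂ : Set V₂}
    (hv : v₁ ∈ S₁ ↔ v₂ ∈ S₂) : q ⁻¹' (p '' S₁ ∪ q '' S₂) = S₂ := by
  rw [Set.union_comm]
  exact h.symm.preimage_left hv.symm

end IsWedge

/-! ### Pointed cuts and the additive defect. -/

/-- The condition on a subset `S` of the vertices of a pointed graph `(H, v)` saying that `S` is a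
cut set of the graph obtained from `H` by attaching a leaf at `v`. -/
def IsPointedCut (H : SimpleGraph V) (v : V) (S : Set V) : Prop :=
  (∀ a ∈ S, a ≠ v → H.CutAt S a) ∧ (v ∈ S → ∃ b, H.Adj v b ∧ b ∉ S)

lemma isPointedCut_empty (H : SimpleGraph V) (v : V) : H.IsPointedCut v ∅ :=
  ⟨fun _ h => h.elim, fun h => h.elim⟩

lemma isPointedCut_singleton {H : SimpleGraph V} {v b : V} (h : H.Adj v b) :
    H.IsPointedCut v {v} :=
  ⟨fun _ h h' => absurd h h', fun _ => ⟨b, h, h.ne'⟩⟩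

open Classical in
/-- The defect of `S` in the pointed graph `(H, v)`: the difference between the number of
components of `H - S` and its expected value, once a leaf is attached at `v`. -/
noncomputable def defect (H : SimpleGraph V) (v : V) (S : Set V) : ℤ :=
  -- The factor 2 compensates for removed vertices counting as components. The last term is the
  -- attached leaf, which becomes a new component exactly when `v` is removed.
  H.avoidComponents S - 2 * S.ncard - 1 + if v ∈ S then 1 else 0

lemma connected_of_card {H : SimpleGraph V} (h : Nat.card H.ConnectedComponent = 1) :
    H.Connected := by
  obtain ⟨h1, ⟨c⟩⟩ := Nat.card_eq_one_iff_unique.mp h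
  have : Nonempty V := ⟨c.out⟩
  exact ⟨fun a b => ConnectedComponent.eq.mp (Subsingleton.elim _ _)⟩

lemma Connected.defect_empty {H : SimpleGraph V} (hH : H.Connected) (v : V) :
    H.defect v ∅ = 0 := by
  simp [defect, hH.avoidComponents_empty]

/-- `u` is a vertex of degree two adjacent to `v`. -/
def IsDegreeTwoNeighbor (H : SimpleGraph V) (v u : V) : Prop :=
  ∃ w, w ≠ v ∧ ∀ x, H.Adj u x ↔ x = v ∨ x = w

namespace IsWedge

variable {H₁ : SimpleGraph V₁} {H₂ : SimpleGraph V₂} {H : SimpleGraph V}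
  {p : V₁ → V} {q : V₂ → V} {v₁ : V₁} {v₂ : V₂}

/-- Components and removed vertices are each additive up to the common vertex. If that vertex lies
in `S` it is subtracted twice too often by the factor 2, and the corrections `+ 1` in the two
defects absorb this. -/
lemma avoidComponents_eq [Finite V₁] [Finite V₂] [Finite V] (h : IsWedge H₁ H₂ H p q v₁ v₂)
    (S : Set V) :
    (H.avoidComponents S : ℤ) - 2 * S.ncard - 1 =
      H₁.defect v₁ (p ⁻¹' S) + H₂.defect v₂ (q ⁻¹' S) := by
  classical
  have h1 := (h.avoid S).card_connectedComponent
  have h2 : S.ncard + (if p v₁ ∈ S then 1 else 0) = (p ⁻¹' S).ncard + (q ⁻¹' S).ncard := by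
    have e : S = p '' (p ⁻¹' S) ∪ q '' (q ⁻¹' S) := by
      ext x
      constructor
      · intro hx
        rcases h.cover x with ⟨a, rfl⟩ | ⟨b, rfl⟩
        · exact .inl ⟨a, hx, rfl⟩
        · exact .inr ⟨b, hx, rfl⟩
      · rintro (⟨a, ha, rfl⟩ | ⟨b, hb, rfl⟩) <;> assumption
    have e' : (p '' (p ⁻¹' S) ∩ q '' (q ⁻¹' S)).ncard = if p v₁ ∈ S then 1 else 0 := by
      split_ifs with hv
      · rw [Set.ncard_eq_one]
        refine ⟨p v₁, Set.eq_singleton_iff_unique_mem.mpr ⟨⟨⟨v₁, hv, rfl⟩, v₂, ?_, h.point.symm⟩, ?_⟩⟩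
        · rw [Set.mem_preimage, ← h.point]; exact hv
        · rintro x ⟨⟨a, -, rfl⟩, b, -, hb⟩
          rw [((h.eq_iff _ _).mp hb.symm).1]
      · rw [Set.ncard_eq_zero]
        refine Set.eq_empty_of_forall_notMem ?_
        rintro x ⟨⟨a, ha, rfl⟩, b, -, hb⟩
        rw [((h.eq_iff _ _).mp hb.symm).1] at ha
        exact hv ha
    have key := Set.ncard_union_add_ncard_inter (p '' (p ⁻¹' S)) (q '' (q ⁻¹' S))
    rwa [← e, e', Set.ncard_image_of_injective _ h.inj_left,
      Set.ncard_image_of_injective _ h.inj_right] at key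
  have hv2 : v₂ ∈ q ⁻¹' S ↔ p v₁ ∈ S := by rw [h.point]; rfl
  simp only [defect, avoidComponents, hv2, Set.mem_preimage]
  split_ifs at h2 ⊢ <;> omega

lemma connected [Finite V₁] [Finite V₂] (h : IsWedge H₁ H₂ H p q v₁ v₂)
    (h₁ : H₁.Connected) (h₂ : H₂.Connected) : H.Connected := by
  have := h.card_connectedComponent
  have e₁ := h₁.avoidComponents_empty
  have e₂ := h₂.avoidComponents_empty
  simp only [avoidComponents, avoid_empty] at e₁ e₂
  exact connected_of_card (by omega)

lemma connected_left (h : IsWedge H₁ H₂ H p q v₁ v₂)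
    (hH : H.Connected) : H₁.Connected := by
  have : Nonempty V₁ := ⟨v₁⟩
  exact ⟨fun a b => h.reachable_left.mp (hH.preconnected _ _)⟩

lemma cutAt_of_isPointedCut (h : IsWedge H₁ H₂ H p q v₁ v₂) {S : Set V}
    (h₁ : H₁.IsPointedCut v₁ (p ⁻¹' S)) (h₂ : H₂.IsPointedCut v₂ (q ⁻¹' S)) :
    ∀ x ∈ S, H.CutAt S x := by
  intro x hx
  by_cases hxv : x = p v₁
  · subst hxv
    obtain ⟨a, ha, haS⟩ := h₁.2 hx
    obtain ⟨b, hb, hbS⟩ := h₂.2 (by rw [h.point] at hx; exact hx)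
    exact h.cutAt_point hx ha hb haS hbS
  · rcases h.cover x with ⟨a, rfl⟩ | ⟨b, rfl⟩
    · have ha : a ≠ v₁ := fun e => hxv (e ▸ rfl)
      exact (h.cutAt_left ha).mpr (h₁.1 a hx ha)
    · have hb : b ≠ v₂ := fun e => hxv (by rw [e, h.point])
      exact (h.cutAt_right hb).mpr (h₂.1 b hx hb)

/-- When the common vertex is in `S`, the degree-two vertex `u` has at most one neighbour left and
cannot be a cut. So `u` stays outside `S` and is the required surviving neighbour on its side. -/
lemma isPointedCut_left (h : IsWedge H₁ H₂ H p q v₁ v₂) {S : Set V}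
    (hS : ∀ x ∈ S, H.CutAt S x) {u : V₁} (hu : H₁.IsDegreeTwoNeighbor v₁ u) :
    H₁.IsPointedCut v₁ (p ⁻¹' S) := by
  have hcut (a : V₁) (ha : a ∈ p ⁻¹' S) (hav : a ≠ v₁) : H₁.CutAt (p ⁻¹' S) a :=
    (h.cutAt_left hav).mp (hS _ ha)
  refine ⟨hcut, fun hv => ?_⟩
  obtain ⟨w, hw, hadj⟩ := hu
  have huv : H₁.Adj u v₁ := (hadj _).mpr (.inl rfl)
  refine ⟨u, huv.symm, fun huS => ?_⟩
  obtain ⟨a, b, ha, hb, haS, hbS, hab⟩ := hcut u huS huv.ne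
  have ha' := ((hadj a).mp ha).resolve_left fun e => haS (e ▸ hv)
  have hb' := ((hadj b).mp hb).resolve_left fun e => hbS (e ▸ hv)
  rw [ha', hb'] at hab
  exact hab .rfl

lemma forall_cutAt_iff (h : IsWedge H₁ H₂ H p q v₁ v₂) {S : Set V} {u₁ : V₁} {u₂ : V₂}
    (hu₁ : H₁.IsDegreeTwoNeighbor v₁ u₁) (hu₂ : H₂.IsDegreeTwoNeighbor v₂ u₂) :
    (∀ x ∈ S, H.CutAt S x) ↔
      H₁.IsPointedCut v₁ (p ⁻¹' S) ∧ H₂.IsPointedCut v₂ (q ⁻¹' S) :=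
  ⟨fun hS => ⟨h.isPointedCut_left hS hu₁, h.symm.isPointedCut_left hS hu₂⟩,
    fun ⟨h₁, h₂⟩ => h.cutAt_of_isPointedCut h₁ h₂⟩

end IsWedge

/-! ### Bipartite wedges with vanishing total defect. -/

/-- The vertex `x` has at most one neighbour. -/
def AtMostOneNeighbor (H : SimpleGraph V) (x : V) : Prop :=
  ∀ y z, H.Adj x y → H.Adj x z → y = z

/-- In a bipartite graph, removing all vertices of one colour class with at least two neighbours
separates any two vertices of the other class. -/
lemma eq_of_reachable_avoid {H : SimpleGraph V} {D : V → Prop}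
    (hD : ∀ x y, H.Adj x y → (D x ↔ ¬ D y)) {S : Set V}
    (hS : ∀ x, D x → ¬ H.AtMostOneNeighbor x → x ∈ S) {a b : V} (ha : ¬ D a) (hb : ¬ D b)
    (hab : (H.avoid S).Reachable a b) : a = b := by
  classical
  -- A `D`-vertex outside `S` has at most one neighbour and is labelled by it; the other class is
  -- labelled by itself. This labelling is constant on the remaining edges.
  let l (x : V) : V := if h : D x ∧ ∃ y, H.Adj x y then h.2.choose else x
  have hl (x : V) (hx : ¬ D x) : l x = x := dif_neg fun h => hx h.1
  have key (x y : V) (hxy : (H.avoid S).Adj x y) (hx : D x) : l x = l y := by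
    have h : D x ∧ ∃ y, H.Adj x y := ⟨hx, y, hxy.1⟩
    rw [hl y ((hD _ _ hxy.1).mp hx)]
    simp only [l, dif_pos h]
    by_contra hne
    exact hxy.2.1 (hS x hx fun hleaf => hne (hleaf _ _ h.2.choose_spec hxy.1))
  have := hab.eq_of_forall_adj (l := l) fun x y hxy => by
    by_cases hx : D x
    · exact key x y hxy hx
    · exact (key y x hxy.symm ((hD _ _ hxy.1.symm).mpr hx)).symm
  rwa [hl a ha, hl b hb] at this

lemma cutAt_of_two_neighbors {H : SimpleGraph V} {D : V → Prop}
    (hD : ∀ x y, H.Adj x y → (D x ↔ ¬ D y)) {S : Set V}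
    (hS : ∀ x, D x → ¬ H.AtMostOneNeighbor x → x ∈ S) {x a b : V} (hx : D x)
    (ha : H.Adj x a) (hb : H.Adj x b) (haS : a ∉ S) (hbS : b ∉ S) (hab : a ≠ b) :
    H.CutAt S x :=
  ⟨a, b, ha, hb, haS, hbS, fun h =>
    hab (eq_of_reachable_avoid hD hS ((hD _ _ ha).mp hx) ((hD _ _ hb).mp hx) h)⟩

lemma defect_singleton [Finite V] (H : SimpleGraph V) (v : V) :
    H.defect v {v} = H.avoidComponents {v} - 2 := by
  simp [defect]

lemma two_le_avoidComponents_singleton [Finite V] {H : SimpleGraph V} {v a : V} (ha : H.Adj v a) :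
    2 ≤ H.avoidComponents {v} := by
  have : Nontrivial (H.avoid {v}).ConnectedComponent :=
    ⟨(H.avoid {v}).connectedComponentMk v, (H.avoid {v}).connectedComponentMk a, fun e =>
      not_reachable_avoid (Set.mem_singleton v) ha.ne (ConnectedComponent.eq.mp e)⟩
  exact Finite.one_lt_card

/-- If `H - v` is connected and `v` has two neighbours then no neighbour of `v` is a leaf. -/
lemma not_atMostOneNeighbor [Finite V] {H : SimpleGraph V} {v u w : V} (hu : H.Adj v u)
    (hw : H.Adj v w) (huw : u ≠ w) (hc : H.avoidComponents {v} = 2) :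
    ¬ H.AtMostOneNeighbor u := by
  intro hleaf
  have := Fintype.ofFinite (H.avoid {v}).ConnectedComponent
  -- A leaf `u` is isolated once `v` is removed, so `v`, `u` and `w` lie in three different
  -- components.
  have h3 : 2 < Fintype.card (H.avoid {v}).ConnectedComponent := by
    rw [Fintype.two_lt_card_iff]
    refine ⟨(H.avoid {v}).connectedComponentMk v, (H.avoid {v}).connectedComponentMk u,
      (H.avoid {v}).connectedComponentMk w, ?_, ?_, ?_⟩
    · exact fun e => not_reachable_avoid (Set.mem_singleton v) hu.ne (ConnectedComponent.eq.mp e)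
    · exact fun e => not_reachable_avoid (Set.mem_singleton v) hw.ne (ConnectedComponent.eq.mp e)
    · intro e
      refine huw ?_
      refine (ConnectedComponent.eq.mp e).rel_of_forall_adj (G := H.avoid {v})
        (R := fun x y => x = u → x = y) (fun _ _ => rfl) ?_ rfl
      rintro x y z ⟨hxy, -, hy⟩ - rfl
      exact absurd (hleaf _ _ hxy hu.symm) hy
  rw [avoidComponents, Nat.card_eq_fintype_card] at hc
  omega

namespace IsWedge

variable {H₁ : SimpleGraph V₁} {H₂ : SimpleGraph V₂} {H : SimpleGraph V}
  {p : V₁ → V} {q : V₂ → V} {v₁ : V₁} {v₂ : V₂}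

/-- The common vertex has to be a cut on the right only. This permits sets `S₁` containing `v₁` and
all its neighbours on the left, which are not pointed cuts. -/
lemma defect_add_defect_eq_zero_of_cutAt (h : IsWedge H₁ H₂ H p q v₁ v₂)
    (hH : ∀ S, (∀ x ∈ S, H.CutAt S x) → H₁.defect v₁ (p ⁻¹' S) + H₂.defect v₂ (q ⁻¹' S) = 0)
    {S₁ : Set V₁} {S₂ : Set V₂} (hv : v₁ ∈ S₁ ↔ v₂ ∈ S₂)
    (h₁ : ∀ a ∈ S₁, a ≠ v₁ → H₁.CutAt S₁ a) (h₂ : ∀ b ∈ S₂, H₂.CutAt S₂ b) :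
    H₁.defect v₁ S₁ + H₂.defect v₂ S₂ = 0 := by
  have e₁ := h.preimage_left hv
  have e₂ := h.preimage_right hv
  have := hH (p '' S₁ ∪ q '' S₂) ?_
  · rwa [e₁, e₂] at this
  · rintro x (⟨a, ha, rfl⟩ | ⟨b, hb, rfl⟩)
    · by_cases hav : a = v₁
      · subst hav
        rw [h.point]
        refine h.symm.cutAt_of_cutAt_left ?_
        rw [e₂]
        exact h₂ _ (hv.mp ha)
      · refine h.cutAt_of_cutAt_left ?_
        rw [e₁]
        exact h₁ a ha hav
    · refine h.symm.cutAt_of_cutAt_left ?_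
      rw [e₂]
      exact h₂ b hb

lemma defect_add_defect_eq_zero (h : IsWedge H₁ H₂ H p q v₁ v₂)
    (hH : ∀ S, (∀ x ∈ S, H.CutAt S x) → H₁.defect v₁ (p ⁻¹' S) + H₂.defect v₂ (q ⁻¹' S) = 0)
    {S₁ : Set V₁} {S₂ : Set V₂} (hv : v₁ ∈ S₁ ↔ v₂ ∈ S₂)
    (h₁ : H₁.IsPointedCut v₁ S₁) (h₂ : H₂.IsPointedCut v₂ S₂) :
    H₁.defect v₁ S₁ + H₂.defect v₂ S₂ = 0 := by
  have e₁ := h.preimage_left hv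
  have e₂ := h.preimage_right hv
  have := hH (p '' S₁ ∪ q '' S₂) (h.cutAt_of_isPointedCut (by rwa [e₁]) (by rwa [e₂]))
  rwa [e₁, e₂] at this

/-- Both defects are nonnegative, because a vertex with a neighbour is a component of its own after
removal, and their sum is zero. -/
lemma defect_singleton_eq_zero [Finite V₁] [Finite V₂] (h : IsWedge H₁ H₂ H p q v₁ v₂)
    (hH : ∀ S, (∀ x ∈ S, H.CutAt S x) → H₁.defect v₁ (p ⁻¹' S) + H₂.defect v₂ (q ⁻¹' S) = 0)
    {a₁ : V₁} {a₂ : V₂} (ha₁ : H₁.Adj v₁ a₁) (ha₂ : H₂.Adj v₂ a₂) :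
    H₁.defect v₁ {v₁} = 0 ∧ H₂.defect v₂ {v₂} = 0 := by
  have key := h.defect_add_defect_eq_zero hH (S₁ := {v₁}) (S₂ := {v₂}) (by simp)
    (isPointedCut_singleton ha₁) (isPointedCut_singleton ha₂)
  have h1 := two_le_avoidComponents_singleton ha₁
  have h2 := two_le_avoidComponents_singleton ha₂
  rw [defect_singleton, defect_singleton] at *
  omega

/-- The left part of a wedge with constant defects has defect zero. -/
lemma defect_left_eq_zero [Finite V₁] [Finite V₂] (h : IsWedge H₁ H₂ H p q v₁ v₂)
    (hc₂ : H₂.Connected)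
    (hH : ∀ S, (∀ x ∈ S, H.CutAt S x) → H₁.defect v₁ (p ⁻¹' S) + H₂.defect v₂ (q ⁻¹' S) = 0)
    {a₁ : V₁} {a₂ : V₂} (ha₁ : H₁.Adj v₁ a₁) (ha₂ : H₂.Adj v₂ a₂) {S₁ : Set V₁}
    (hS₁ : H₁.IsPointedCut v₁ S₁) : H₁.defect v₁ S₁ = 0 := by
  -- The set is completed on the right by `{v₂}` or `∅`, whichever agrees with it at the common
  -- vertex; both have defect zero.
  by_cases hv : v₁ ∈ S₁
  · have key := h.defect_add_defect_eq_zero hH (S₂ := {v₂}) (by simp [hv]) hS₁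
      (isPointedCut_singleton ha₂)
    rwa [(h.defect_singleton_eq_zero hH ha₁ ha₂).2, add_zero] at key
  · have key := h.defect_add_defect_eq_zero hH (S₂ := ∅) (by simp [hv]) hS₁
      (isPointedCut_empty _ _)
    rwa [hc₂.defect_empty, add_zero] at key

/-- In a bipartite wedge with constant defects, the common vertex has a neighbour of degree two on
each side. -/
lemma exists_isDegreeTwoNeighbor_left [Finite V₁] [Finite V₂] (h : IsWedge H₁ H₂ H p q v₁ v₂)
    (hc₁ : H₁.Connected) (hc₂ : H₂.Connected) {D : V → Prop}
    (hD : ∀ x y, H.Adj x y → (D x ↔ ¬ D y)) (hDv : D (p v₁))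
    (hH : ∀ S, (∀ x ∈ S, H.CutAt S x) → H₁.defect v₁ (p ⁻¹' S) + H₂.defect v₂ (q ⁻¹' S) = 0)
    {a₁ b₁ : V₁} {a₂ b₂ : V₂} (ha₁ : H₁.Adj v₁ a₁) (hb₁ : H₁.Adj v₁ b₁) (hab₁ : a₁ ≠ b₁)
    (ha₂ : H₂.Adj v₂ a₂) (hb₂ : H₂.Adj v₂ b₂) (hab₂ : a₂ ≠ b₂) :
    ∃ u, H₁.IsDegreeTwoNeighbor v₁ u := by
  by_contra! hno
  have hD₁ (x y : V₁) (hxy : H₁.Adj x y) : ¬ D (p x) ↔ ¬ ¬ D (p y) := by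
    rw [hD _ _ ((h.adj_left _ _).mpr hxy)]
  have hD₂ (x y : V₂) (hxy : H₂.Adj x y) : D (q x) ↔ ¬ D (q y) :=
    hD _ _ ((h.adj_right _ _).mpr hxy)
  have hleaf (u : V₁) (hu : H₁.Adj v₁ u) : ¬ H₁.AtMostOneNeighbor u := by
    have hc : H₁.avoidComponents {v₁} = 2 := by
      have := (h.defect_singleton_eq_zero hH ha₁ ha₂).1
      rw [defect_singleton] at this
      omega
    by_cases hua : u = a₁
    · exact not_atMostOneNeighbor hu hb₁ (hua ▸ hab₁) hc
    · exact not_atMostOneNeighbor hu ha₁ hua hc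
  -- `Y` takes the colour opposite to the common vertex, whereas `X` takes its colour and contains
  -- it.
  let Y : Set V₁ := {a | ¬ D (p a) ∧ ¬ H₁.AtMostOneNeighbor a}
  let X : Set V₂ := {b | D (q b) ∧ ¬ H₂.AtMostOneNeighbor b}
  have hvY : v₁ ∉ Y := fun hv => hv.1 hDv
  -- This is where the absence of a degree-two neighbour enters: elements of `Y` remain cuts even
  -- after `v₁` is removed.
  have hnb (a : V₁) (ha : a ∈ Y) : ∃ b c, H₁.Adj a b ∧ H₁.Adj a c ∧ b ≠ v₁ ∧ c ≠ v₁ ∧ b ≠ c := by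
    have h2 := ha.2
    simp only [AtMostOneNeighbor] at h2
    push Not at h2
    obtain ⟨y, z, hy, hz, hyz⟩ := h2
    have key (w : V₁) (hv : H₁.Adj a v₁) (hw : H₁.Adj a w) (hwv : w ≠ v₁) :
        ∃ b c, H₁.Adj a b ∧ H₁.Adj a c ∧ b ≠ v₁ ∧ c ≠ v₁ ∧ b ≠ c := by
      by_contra! hcon
      refine hno a ⟨w, hwv, fun x => ⟨fun hx => ?_, ?_⟩⟩
      · by_contra! hx'
        exact hx'.2 (hcon x w hx hw hx'.1 hwv)
      · rintro (rfl | rfl) <;> assumption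
    by_cases hyv : y = v₁
    · exact key z (hyv ▸ hy) hz (fun e => hyz (hyv.trans e.symm))
    by_cases hzv : z = v₁
    · exact key y (hzv ▸ hz) hy hyv
    exact ⟨y, z, hy, hz, hyv, hzv, hyz⟩
  have hYcut (T : Set V₁) (hT : ∀ x ∈ T, x ∉ Y → x = v₁) (hYT : Y ⊆ T) (a : V₁) (ha : a ∈ Y) :
      H₁.CutAt T a := by
    obtain ⟨b, c, hb, hc, hbv, hcv, hbc⟩ := hnb a ha
    have hout (x : V₁) (hx : H₁.Adj a x) (hxv : x ≠ v₁) : x ∉ T := fun hxT =>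
      hxv (hT x hxT fun hxY => (hD₁ _ _ hx).mp ha.1 hxY.1)
    exact cutAt_of_two_neighbors hD₁ (fun x h1 h2 => hYT ⟨h1, h2⟩) ha.1 hb hc (hout b hb hbv)
      (hout c hc hcv) hbc
  have hXcut (b : V₂) (hb : b ∈ X) : H₂.CutAt X b := by
    have h2 := hb.2
    simp only [AtMostOneNeighbor] at h2
    push Not at h2
    obtain ⟨y, z, hy, hz, hyz⟩ := h2
    exact cutAt_of_two_neighbors (S := X) hD₂ (fun x h1 h2 => ⟨h1, h2⟩) hb.1 hy hz
      (fun hyX => (hD₂ _ _ hy).mp hb.1 hyX.1) (fun hzX => (hD₂ _ _ hz).mp hb.1 hzX.1) hyz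
  have hvX : v₂ ∈ X := ⟨h.point ▸ hDv, fun hl => hab₂ (hl _ _ ha₂ hb₂)⟩
  have hX0 : H₂.defect v₂ X = 0 :=
    h.symm.defect_left_eq_zero hc₁ (fun S hS => by rw [add_comm]; exact hH S hS) ha₂ ha₁
      ⟨fun b hb _ => hXcut b hb, fun _ => ⟨a₂, ha₂, fun haX => (hD₂ _ _ ha₂).mp hvX.1 haX.1⟩⟩
  have hY0 : H₁.defect v₁ Y = 0 :=
    h.defect_left_eq_zero hc₂ hH ha₁ ha₂
      ⟨fun a ha _ => hYcut Y (fun _ h1 h2 => absurd h1 h2) subset_rfl a ha, fun hv => absurd hv hvY⟩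
  have hYv : H₁.defect v₁ (insert v₁ Y) + H₂.defect v₂ X = 0 := by
    refine h.defect_add_defect_eq_zero_of_cutAt hH (by simp [hvX]) (fun a ha hav => ?_) hXcut
    exact hYcut _ (fun x hx hxY => hx.resolve_right hxY) (Set.subset_insert _ _) a
      (ha.resolve_left hav)
  -- No neighbour of `v₁` is a leaf, so all of them lie in `Y` and `v₁` is already isolated.
  have hav : H₁.avoid (insert v₁ Y) = H₁.avoid Y := by
    refine le_antisymm (H₁.avoid_anti (Set.subset_insert _ _)) fun x y hxy => ?_
    have hend (x y : V₁) (hxy : (H₁.avoid Y).Adj x y) : x ∉ insert v₁ Y := by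
      rintro (hxv | hx)
      · rw [hxv] at hxy
        have hyY : y ∈ Y :=
          ⟨fun hy => (hD₁ _ _ hxy.1).mpr (not_not.mpr hy) hDv, hleaf y hxy.1⟩
        exact hxy.2.2 hyY
      · exact hxy.2.1 hx
    exact ⟨hxy.1, hend x y hxy, hend y x hxy.symm⟩
  have hcard : (insert v₁ Y).ncard = Y.ncard + 1 := Set.ncard_insert_of_notMem hvY
  -- With the components unchanged, adding `v₁` changes the defect by $-2+1=-1$, yet both defects
  -- should be zero.
  rw [hX0] at hYv
  simp only [defect, avoidComponents, hav, hcard, hvY, Set.mem_insert_iff, true_or, if_true,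
    if_false] at hYv hY0
  push_cast at hYv
  omega

end IsWedge

end SimpleGraph

/-! ### Leaves as wedges with an edge, and the graph $G_1\circ G_2$. -/

section Gluing

variable {K : Type*} [Field K] {V V₁ V₂ : Type*}

open SimpleGraph

lemma isUnmixed_iff_defect [Finite V₁] [Finite V₂] [Finite V] {H₁ : SimpleGraph V₁}
    {H₂ : SimpleGraph V₂} {H : SimpleGraph V} {p : V₁ → V} {q : V₂ → V} {v₁ : V₁} {v₂ : V₂}
    (h : IsWedge H₁ H₂ H p q v₁ v₂) (hH : H.Connected) :
    (binomialEdgeIdeal K H).IsUnmixed ↔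
      ∀ S, (∀ x ∈ S, H.CutAt S x) → H₁.defect v₁ (p ⁻¹' S) + H₂.defect v₂ (q ⁻¹' S) = 0 := by
  rw [isUnmixed_iff hH]
  simp only [mem_cutSets_iff]
  refine forall₂_congr fun S _ => ?_
  have := h.avoidComponents_eq S
  omega

/-- A graph with a leaf `f` at `v` is the wedge of `G - f` and an edge. -/
lemma isWedge_leaf {G : SimpleGraph V} {f v : V} (hfv : G.Adj f v)
    (hf : ∀ x, G.Adj f x → x = v) :
    IsWedge (G.induce {f}ᶜ) (⊤ : SimpleGraph Bool) G Subtype.val (fun b => if b then f else v)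
      ⟨v, hfv.ne'⟩ false where
  inj_left := Subtype.val_injective
  inj_right := by
    have := hfv.ne
    intro a b
    cases a <;> cases b <;> simp [this, this.symm]
  cover x := by
    by_cases hx : x = f
    · exact .inr ⟨true, by simp [hx]⟩
    · exact .inl ⟨⟨x, hx⟩, rfl⟩
  eq_iff := by
    rintro ⟨a, ha : a ≠ f⟩ b
    cases b <;> simp [ha, Subtype.ext_iff]
  adj_left _ _ := Iff.rfl
  adj_right b b' := by
    have := hfv.symm
    cases b <;> cases b' <;> simp [hfv, this]
  adj_cross := by
    rintro ⟨a, ha⟩ b hab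
    cases b
    · simp
    · exact .inl (Subtype.ext (hf a (by simpa using hab.symm)))

lemma not_cutAt_of_unique_neighbor {G : SimpleGraph V} {f v : V}
    (hf : ∀ x, G.Adj f x → x = v) (S : Set V) : ¬ G.CutAt S f := by
  rintro ⟨a, b, ha, hb, -, -, hab⟩
  rw [hf a ha, hf b hb] at hab
  exact hab .rfl

/-- A leaf is never a cut, so it survives as a neighbour of `v`. Hence the only demand on `v ∈ S` is
a second surviving neighbour. -/
lemma forall_cutAt_iff_of_leaf {G : SimpleGraph V} {f v : V} (hfv : G.Adj f v)
    (hf : ∀ x, G.Adj f x → x = v) (S : Set V) :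
    (∀ x ∈ S, G.CutAt S x) ↔
      f ∉ S ∧ (G.induce {f}ᶜ).IsPointedCut ⟨v, hfv.ne'⟩ (Subtype.val ⁻¹' S) := by
  have hw := isWedge_leaf hfv hf
  constructor
  · intro h
    have hfS : f ∉ S := fun hS => not_cutAt_of_unique_neighbor hf S (h f hS)
    refine ⟨hfS, fun a ha hav => (hw.cutAt_left hav).mp (h a ha), fun hv => ?_⟩
    obtain ⟨a, b, ha, hb, haS, hbS, hab⟩ := h v hv
    by_cases haf : a = f
    · have hbf : b ≠ f := by
        rintro rfl
        rw [haf] at hab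
        exact hab .rfl
      exact ⟨⟨b, hbf⟩, hb, hbS⟩
    · exact ⟨⟨a, haf⟩, ha, haS⟩
  · rintro ⟨hfS, h⟩
    refine hw.cutAt_of_isPointedCut h ⟨fun b hb hb' => ?_, fun _ => ⟨true, by simp, by simpa⟩⟩
    cases b
    · exact absurd rfl hb'
    · exact absurd (by simpa using hb) hfS

lemma connected_induce_of_leaf {G : SimpleGraph V} {f v : V} (hG : G.Connected)
    (hfv : G.Adj f v) (hf : ∀ x, G.Adj f x → x = v) : (G.induce {f}ᶜ).Connected :=
  (isWedge_leaf hfv hf).connected_left hG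

/-- Unmixedness in terms of the pointed graph obtained by removing a leaf. -/
lemma isUnmixed_iff_of_leaf [Finite V] {G : SimpleGraph V} {f v : V} (hG : G.Connected)
    (hfv : G.Adj f v) (hf : ∀ x, G.Adj f x → x = v) :
    (binomialEdgeIdeal K G).IsUnmixed ↔
      ∀ S, (G.induce {f}ᶜ).IsPointedCut ⟨v, hfv.ne'⟩ S →
        (G.induce {f}ᶜ).defect ⟨v, hfv.ne'⟩ S = 0 := by
  have hw := isWedge_leaf hfv hf
  -- The edge carrying the leaf contributes no defect, so only the defect of $G-f$ remains.
  have key (S : Set V) (hS : f ∉ S) : (⊤ : SimpleGraph Bool).defect false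
      ((fun b : Bool => if b then f else v) ⁻¹' S) = 0 := by
    by_cases hv : v ∈ S
    · have e : ((fun b : Bool => if b then f else v) ⁻¹' S) = {false} := by
        ext b; cases b <;> simp [hv, hS]
      have h2 := two_le_avoidComponents_singleton
        (show (⊤ : SimpleGraph Bool).Adj false true by simp)
      have h3 : (⊤ : SimpleGraph Bool).avoidComponents {false} ≤ Nat.card Bool :=
        Nat.card_le_card_of_surjective ((⊤ : SimpleGraph Bool).avoid {false}).connectedComponentMk
          Quot.mk_surjective
      rw [Nat.card_eq_fintype_card, Fintype.card_bool] at h3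
      rw [e, defect_singleton]
      omega
    · have e : ((fun b : Bool => if b then f else v) ⁻¹' S) = ∅ := by
        ext b; cases b <;> simp [hv, hS]
      rw [e, connected_top.defect_empty]
  rw [isUnmixed_iff_defect hw hG]
  constructor
  · intro h S hS
    have e : (Subtype.val ⁻¹' (Subtype.val '' S) : Set ({f}ᶜ : Set V)) = S :=
      Set.preimage_image_eq _ Subtype.val_injective
    have hfS : f ∉ Subtype.val '' S := by
      rintro ⟨x, -, hx⟩
      exact x.2 hx
    have := h (Subtype.val '' S) ((forall_cutAt_iff_of_leaf hfv hf _).mpr ⟨hfS, by rwa [e]⟩)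
    rwa [key _ hfS, add_zero, e] at this
  · intro h S hS
    obtain ⟨hfS, hS'⟩ := (forall_cutAt_iff_of_leaf hfv hf S).mp hS
    rw [key S hfS, add_zero]
    exact h _ hS'

/-- A vertex `u` of degree two adjacent to `v`, seen in `G` and in `G` minus a leaf at `v`. -/
lemma exists_degree_eq_two_iff [Fintype V] {G : SimpleGraph V} [DecidableRel G.Adj] {f v : V}
    (hfv : G.Adj f v) (hf : ∀ x, G.Adj f x → x = v) :
    (∃ u, G.Adj v u ∧ G.degree u = 2) ↔
      ∃ u, (G.induce {f}ᶜ).IsDegreeTwoNeighbor ⟨v, hfv.ne'⟩ u := by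
  classical
  constructor
  · rintro ⟨u, hvu, hu⟩
    have hw : ∃ w, w ≠ v ∧ ∀ x, G.Adj u x ↔ x = v ∨ x = w := by
      rw [← card_neighborFinset_eq_degree, Finset.card_eq_two] at hu
      obtain ⟨a, b, hab, hu⟩ := hu
      have hadj (x : V) : G.Adj u x ↔ x = a ∨ x = b := by
        rw [← mem_neighborFinset, hu]; simp
      rcases (hadj v).mp hvu.symm with rfl | rfl
      · exact ⟨b, hab.symm, hadj⟩
      · exact ⟨a, hab, fun x => (hadj x).trans or_comm⟩
    obtain ⟨w, hwv, hw⟩ := hw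
    have hwu : G.Adj u w := (hw w).mpr (.inr rfl)
    have huf : u ≠ f := by
      rintro rfl
      exact hwv (hf w hwu)
    have hwf : w ≠ f := by
      rintro rfl
      exact hvu.ne' (hf u hwu.symm)
    refine ⟨⟨u, huf⟩, ⟨w, hwf⟩, fun e => hwv (congrArg Subtype.val e), fun x => ?_⟩
    rw [Subtype.ext_iff, Subtype.ext_iff]
    exact hw x
  · rintro ⟨⟨u, hu⟩, ⟨w, hw⟩, hwv, hadj⟩
    have hvu : G.Adj u v := (hadj ⟨v, hfv.ne'⟩).mpr (.inl rfl)
    refine ⟨u, hvu.symm, ?_⟩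
    rw [← card_neighborFinset_eq_degree, Finset.card_eq_two]
    refine ⟨v, w, fun e => hwv (Subtype.ext e.symm), ?_⟩
    ext x
    rw [mem_neighborFinset, Finset.mem_insert, Finset.mem_singleton]
    by_cases hx : x = f
    · subst hx
      constructor
      · intro h
        exact absurd (hf u h.symm) hvu.ne
      · rintro (h | h)
        · exact absurd h hfv.ne
        · exact absurd h.symm hw
    · have := hadj ⟨x, hx⟩
      rw [Subtype.ext_iff, Subtype.ext_iff] at this
      exact this

variable {G₁ : SimpleGraph V₁} {G₂ : SimpleGraph V₂} {f₁ v₁ : V₁} {f₂ v₂ : V₂}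

lemma gluedLeft_injective (v₂ : V₂) : (gluedLeft v₂ : V₁ → Glued V₁ v₂).Injective :=
  Sum.inl_injective

lemma gluedRight_self (v₁ : V₁) (v₂ : V₂) : gluedRight v₁ v₂ v₂ = gluedLeft v₂ v₁ := by
  simp [gluedRight, gluedLeft]

lemma gluedRight_of_ne (v₁ : V₁) {v₂ b : V₂} (h : b ≠ v₂) :
    gluedRight v₁ v₂ b = Sum.inr ⟨b, h⟩ := by
  simp [gluedRight, h]

lemma gluedRight_injective (v₁ : V₁) (v₂ : V₂) : (gluedRight v₁ v₂).Injective := by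
  intro a b h
  by_cases ha : a = v₂ <;> by_cases hb : b = v₂
  · rw [ha, hb]
  · rw [ha, gluedRight_self, gluedRight_of_ne v₁ hb] at h
    cases h
  · rw [hb, gluedRight_self, gluedRight_of_ne v₁ ha] at h
    cases h
  · rw [gluedRight_of_ne v₁ hb, gluedRight_of_ne v₁ ha] at h
    simpa using h

lemma gluedLeft_eq_gluedRight_iff {a : V₁} {b : V₂} :
    gluedLeft v₂ a = gluedRight v₁ v₂ b ↔ a = v₁ ∧ b = v₂ := by
  by_cases hb : b = v₂
  · subst hb
    rw [gluedRight_self, (gluedLeft_injective b).eq_iff]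
    simp
  · rw [gluedRight_of_ne v₁ hb]
    simp [gluedLeft, hb]

lemma gluedLeft_mem_circVerts (h₂ : f₂ ≠ v₂) {a : V₁} (ha : a ≠ f₁) :
    gluedLeft v₂ a ∈ circVerts f₁ v₁ f₂ v₂ := by
  rintro (h | h)
  · exact ha (gluedLeft_injective v₂ h)
  · exact h₂ (gluedLeft_eq_gluedRight_iff.mp h).2

lemma gluedRight_mem_circVerts (h₁ : f₁ ≠ v₁) {b : V₂} (hb : b ≠ f₂) :
    gluedRight v₁ v₂ b ∈ circVerts f₁ v₁ f₂ v₂ := by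
  rintro (h | h)
  · exact h₁ (gluedLeft_eq_gluedRight_iff.mp h.symm).1
  · exact hb (gluedRight_injective v₁ v₂ h)

/-- The inclusion of `G₁ - f₁` in `G₁ ∘ G₂`. -/
def circLeft (f₁ v₁ : V₁) (h₂ : f₂ ≠ v₂) (a : ({f₁}ᶜ : Set V₁)) : circVerts f₁ v₁ f₂ v₂ :=
  ⟨gluedLeft v₂ a, gluedLeft_mem_circVerts h₂ a.2⟩

/-- The inclusion of `G₂ - f₂` in `G₁ ∘ G₂`. -/
noncomputable def circRight (f₂ v₂ : V₂) (h₁ : f₁ ≠ v₁) (b : ({f₂}ᶜ : Set V₂)) :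
    circVerts f₁ v₁ f₂ v₂ :=
  ⟨gluedRight v₁ v₂ b, gluedRight_mem_circVerts h₁ b.2⟩

/-- `G₁ ∘ G₂` is the wedge of `G₁ - f₁` and `G₂ - f₂`. -/
lemma isWedge_circ (h₁ : f₁ ≠ v₁) (h₂ : f₂ ≠ v₂) :
    IsWedge (G₁.induce {f₁}ᶜ) (G₂.induce {f₂}ᶜ) (circ G₁ G₂ f₁ v₁ f₂ v₂)
      (circLeft f₁ v₁ h₂) (circRight f₂ v₂ h₁) ⟨v₁, h₁.symm⟩ ⟨v₂, h₂.symm⟩ where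
  inj_left a b h := Subtype.ext (gluedLeft_injective v₂ (congrArg Subtype.val h))
  inj_right a b h := Subtype.ext (gluedRight_injective v₁ v₂ (congrArg Subtype.val h))
  cover := by
    rintro ⟨a | ⟨b, hb⟩, hx⟩
    · refine .inl ⟨⟨a, ?_⟩, rfl⟩
      rintro rfl
      exact hx (.inl rfl)
    · refine .inr ⟨⟨b, ?_⟩, Subtype.ext (gluedRight_of_ne v₁ hb)⟩
      rintro rfl
      exact hx (.inr (gluedRight_of_ne v₁ hb).symm)
  eq_iff a b := by
    rw [Subtype.ext_iff, Subtype.ext_iff, Subtype.ext_iff]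
    exact gluedLeft_eq_gluedRight_iff
  adj_left a a' := by
    change (G₁.map (gluedLeft v₂) ⊔ G₂.map (gluedRight v₁ v₂)).Adj (gluedLeft v₂ a)
      (gluedLeft v₂ a') ↔ G₁.Adj a a'
    rw [sup_adj, map_adj', map_adj']
    constructor
    · rintro (h | h)
      · obtain ⟨-, x, y, hxy, hx, hy⟩ := h
        rwa [← gluedLeft_injective v₂ hx, ← gluedLeft_injective v₂ hy]
      · obtain ⟨-, x, y, hxy, hx, hy⟩ := h
        rw [(gluedLeft_eq_gluedRight_iff.mp hx.symm).2,
          (gluedLeft_eq_gluedRight_iff.mp hy.symm).2] at hxy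
        exact absurd rfl hxy.ne
    · intro h
      exact .inl ⟨(gluedLeft_injective v₂).ne h.ne, _, _, h, rfl, rfl⟩
  adj_right b b' := by
    change (G₁.map (gluedLeft v₂) ⊔ G₂.map (gluedRight v₁ v₂)).Adj (gluedRight v₁ v₂ b)
      (gluedRight v₁ v₂ b') ↔ G₂.Adj b b'
    rw [sup_adj, map_adj', map_adj']
    constructor
    · rintro (h | h)
      · obtain ⟨-, x, y, hxy, hx, hy⟩ := h
        rw [(gluedLeft_eq_gluedRight_iff.mp hx).1,
          (gluedLeft_eq_gluedRight_iff.mp hy).1] at hxy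
        exact absurd rfl hxy.ne
      · obtain ⟨-, x, y, hxy, hx, hy⟩ := h
        rwa [← gluedRight_injective v₁ v₂ hx, ← gluedRight_injective v₁ v₂ hy]
    · intro h
      exact .inr ⟨(gluedRight_injective v₁ v₂).ne h.ne, _, _, h, rfl, rfl⟩
  adj_cross a b h := by
    change (G₁.map (gluedLeft v₂) ⊔ G₂.map (gluedRight v₁ v₂)).Adj (gluedLeft v₂ a)
      (gluedRight v₁ v₂ b) at h
    rw [sup_adj, map_adj', map_adj'] at h
    rcases h with h | h
    · obtain ⟨-, x, y, -, -, hy⟩ := h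
      exact .inr (Subtype.ext (gluedLeft_eq_gluedRight_iff.mp hy).2)
    · obtain ⟨-, x, y, -, hx, -⟩ := h
      exact .inl (Subtype.ext (gluedLeft_eq_gluedRight_iff.mp hx.symm).1)

/-- The family `gluedCutSets` in terms of the pointed graphs `G₁ - f₁` and `G₂ - f₂`. -/
lemma gluedCutSets_eq [Finite V₁] [Finite V₂] (hfv₁ : G₁.Adj f₁ v₁)
    (hf₁ : ∀ x, G₁.Adj f₁ x → x = v₁) (hfv₂ : G₂.Adj f₂ v₂) (hf₂ : ∀ x, G₂.Adj f₂ x → x = v₂) :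
    gluedCutSets K G₁ G₂ v₁ v₂ = (fun S : Set (circVerts f₁ v₁ f₂ v₂) => Subtype.val '' S) ''
      {S | (G₁.induce {f₁}ᶜ).IsPointedCut ⟨v₁, hfv₁.ne'⟩ (circLeft f₁ v₁ hfv₂.ne ⁻¹' S) ∧
        (G₂.induce {f₂}ᶜ).IsPointedCut ⟨v₂, hfv₂.ne'⟩ (circRight f₂ v₂ hfv₁.ne ⁻¹' S)} := by
  have hw := isWedge_circ (G₁ := G₁) (G₂ := G₂) hfv₁.ne hfv₂.ne
  have himg (T₁ : Set ({f₁}ᶜ : Set V₁)) (T₂ : Set ({f₂}ᶜ : Set V₂)) :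
      (Subtype.val '' (circLeft f₁ v₁ hfv₂.ne '' T₁ ∪ circRight f₂ v₂ hfv₁.ne '' T₂)) =
        gluedLeft v₂ '' (Subtype.val '' T₁) ∪ gluedRight v₁ v₂ '' (Subtype.val '' T₂) := by
    rw [Set.image_union, Set.image_image, Set.image_image, Set.image_image, Set.image_image]
    rfl
  have hcut₁ (S₁ : Set V₁) := (mem_cutSets_iff (K := K) G₁ S₁).trans
    (forall_cutAt_iff_of_leaf hfv₁ hf₁ S₁)
  have hcut₂ (S₂ : Set V₂) := (mem_cutSets_iff (K := K) G₂ S₂).trans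
    (forall_cutAt_iff_of_leaf hfv₂ hf₂ S₂)
  -- The two sides meet only in the common vertex, so the two families together say just that `S₁`
  -- and `S₂` agree about it.
  have hcore (S₁ : Set V₁) (hS₁ : S₁ ∈ cutSets K G₁) (S₂ : Set V₂) (hS₂ : S₂ ∈ cutSets K G₂)
      (hv : v₁ ∈ S₁ ↔ v₂ ∈ S₂) :
      gluedLeft v₂ '' S₁ ∪ gluedRight v₁ v₂ '' S₂ ∈
        (fun S : Set (circVerts f₁ v₁ f₂ v₂) => Subtype.val '' S) ''
      {S | (G₁.induce {f₁}ᶜ).IsPointedCut ⟨v₁, hfv₁.ne'⟩ (circLeft f₁ v₁ hfv₂.ne ⁻¹' S) ∧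
        (G₂.induce {f₂}ᶜ).IsPointedCut ⟨v₂, hfv₂.ne'⟩ (circRight f₂ v₂ hfv₁.ne ⁻¹' S)} := by
    obtain ⟨hf₁S, hP₁⟩ := (hcut₁ S₁).mp hS₁
    obtain ⟨hf₂S, hP₂⟩ := (hcut₂ S₂).mp hS₂
    have e₁ : (Subtype.val '' (Subtype.val ⁻¹' S₁ : Set ({f₁}ᶜ : Set V₁))) = S₁ := by
      rw [Subtype.image_preimage_coe, Set.inter_eq_right]
      exact fun x hx hxf => hf₁S (by rwa [← Set.mem_singleton_iff.mp hxf])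
    have e₂ : (Subtype.val '' (Subtype.val ⁻¹' S₂ : Set ({f₂}ᶜ : Set V₂))) = S₂ := by
      rw [Subtype.image_preimage_coe, Set.inter_eq_right]
      exact fun x hx hxf => hf₂S (by rwa [← Set.mem_singleton_iff.mp hxf])
    refine ⟨circLeft f₁ v₁ hfv₂.ne '' (Subtype.val ⁻¹' S₁) ∪
      circRight f₂ v₂ hfv₁.ne '' (Subtype.val ⁻¹' S₂), ⟨?_, ?_⟩, ?_⟩
    · rw [hw.preimage_left (by exact hv)]; exact hP₁
    · rw [hw.preimage_right (by exact hv)]; exact hP₂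
    · exact (himg _ _).trans (by rw [e₁, e₂])
  apply Set.Subset.antisymm
  · rintro T (⟨S₁, hS₁, S₂, hS₂, hv, rfl⟩ | ⟨S₁, hS₁, S₂, hS₂, hv, rfl⟩)
    · refine hcore S₁ hS₁ S₂ hS₂ ⟨fun h => ?_, fun h => ?_⟩
      · exact absurd (.inl ⟨v₁, h, rfl⟩) hv
      · exact absurd (.inr ⟨v₂, h, gluedRight_self v₁ v₂⟩) hv
    · obtain ⟨⟨a, ha, ha'⟩, b, hb, hb'⟩ := hv.ge (Set.mem_singleton _)
      rw [gluedLeft_injective v₂ ha'] at ha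
      rw [(gluedLeft_eq_gluedRight_iff.mp hb'.symm).2] at hb
      exact hcore S₁ hS₁ S₂ hS₂ ⟨fun _ => hb, fun _ => ha⟩
  · rintro T ⟨S, ⟨hP₁, hP₂⟩, rfl⟩
    have hS : S = circLeft f₁ v₁ hfv₂.ne '' (circLeft f₁ v₁ hfv₂.ne ⁻¹' S) ∪
        circRight f₂ v₂ hfv₁.ne '' (circRight f₂ v₂ hfv₁.ne ⁻¹' S) := by
      rw [Set.image_preimage_eq_inter_range, Set.image_preimage_eq_inter_range,
        ← Set.inter_union_distrib_left, Set.left_eq_inter]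
      exact fun x _ => hw.cover x
    have hmem₁ : Subtype.val '' (circLeft f₁ v₁ hfv₂.ne ⁻¹' S) ∈ cutSets K G₁ := by
      refine (hcut₁ _).mpr ⟨?_, ?_⟩
      · rintro ⟨x, -, hx⟩
        exact x.2 hx
      · rwa [Set.preimage_image_eq _ Subtype.val_injective]
    have hmem₂ : Subtype.val '' (circRight f₂ v₂ hfv₁.ne ⁻¹' S) ∈ cutSets K G₂ := by
      refine (hcut₂ _).mpr ⟨?_, ?_⟩
      · rintro ⟨x, -, hx⟩
        exact x.2 hx
      · rwa [Set.preimage_image_eq _ Subtype.val_injective]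
    have hval : Subtype.val '' S = gluedLeft v₂ '' (Subtype.val '' (circLeft f₁ v₁ hfv₂.ne ⁻¹' S)) ∪
        gluedRight v₁ v₂ '' (Subtype.val '' (circRight f₂ v₂ hfv₁.ne ⁻¹' S)) := by
      rw [← himg, ← hS]
    by_cases hv : gluedLeft v₂ v₁ ∈ Subtype.val '' S
    · refine .inr ⟨_, hmem₁, _, hmem₂, Set.eq_singleton_iff_unique_mem.mpr ⟨?_, ?_⟩, hval⟩
      · obtain ⟨x, hx, hx'⟩ := hv
        refine ⟨⟨v₁, ⟨⟨v₁, hfv₁.ne'⟩, ?_, rfl⟩, rfl⟩, v₂, ⟨⟨v₂, hfv₂.ne'⟩, ?_, rfl⟩,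
          gluedRight_self v₁ v₂⟩
        · rwa [show x = circLeft f₁ v₁ hfv₂.ne ⟨v₁, hfv₁.ne'⟩ from Subtype.ext hx'] at hx
        · rwa [show x = circRight f₂ v₂ hfv₁.ne ⟨v₂, hfv₂.ne'⟩ from
            Subtype.ext (hx'.trans (gluedRight_self v₁ v₂).symm)] at hx
      · rintro x ⟨⟨a, -, rfl⟩, b, -, hb⟩
        rw [(gluedLeft_eq_gluedRight_iff.mp hb.symm).1]
    · exact .inl ⟨_, hmem₁, _, hmem₂, by rwa [← hval], hval⟩

lemma image_cutSets_circ [Finite V₁] [Finite V₂] (hfv₁ : G₁.Adj f₁ v₁)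
    (hf₁ : ∀ x, G₁.Adj f₁ x → x = v₁) (hfv₂ : G₂.Adj f₂ v₂) (hf₂ : ∀ x, G₂.Adj f₂ x → x = v₂)
    (hu₁ : ∃ u, (G₁.induce {f₁}ᶜ).IsDegreeTwoNeighbor ⟨v₁, hfv₁.ne'⟩ u)
    (hu₂ : ∃ u, (G₂.induce {f₂}ᶜ).IsDegreeTwoNeighbor ⟨v₂, hfv₂.ne'⟩ u) :
    (fun S => Subtype.val '' S) '' cutSets K (circ G₁ G₂ f₁ v₁ f₂ v₂) =
      gluedCutSets K G₁ G₂ v₁ v₂ := by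
  obtain ⟨u₁, hu₁⟩ := hu₁
  obtain ⟨u₂, hu₂⟩ := hu₂
  rw [gluedCutSets_eq hfv₁ hf₁ hfv₂ hf₂]
  congr 1
  ext S
  rw [mem_cutSets_iff]
  exact (isWedge_circ hfv₁.ne hfv₂.ne).forall_cutAt_iff hu₁ hu₂

lemma eq_of_adj_of_degree_eq_one [Fintype V] {G : SimpleGraph V} [DecidableRel G.Adj] {f v : V}
    (hf : G.degree f = 1) (hfv : G.Adj f v) (x : V) (hx : G.Adj f x) : x = v := by
  obtain ⟨w, -, hw⟩ := degree_eq_one_iff_existsUnique_adj.mp hf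
  rw [hw x hx, hw v hfv]

lemma exists_two_neighbors_of_leaf [Fintype V] {G : SimpleGraph V} [DecidableRel G.Adj] {f v : V}
    (hfv : G.Adj f v) (hv : 3 ≤ G.degree v) :
    ∃ a b, (G.induce {f}ᶜ).Adj ⟨v, hfv.ne'⟩ a ∧ (G.induce {f}ᶜ).Adj ⟨v, hfv.ne'⟩ b ∧ a ≠ b := by
  classical
  have h : 1 < ((G.neighborFinset v).erase f).card := by
    rw [Finset.card_erase_of_mem (by simpa using hfv.symm), card_neighborFinset_eq_degree]
    omega
  obtain ⟨a, ha, b, hb, hab⟩ := Finset.one_lt_card.mp h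
  simp only [Finset.mem_erase, mem_neighborFinset] at ha hb
  exact ⟨⟨a, ha.1⟩, ⟨b, hb.1⟩, ha.2, hb.2, fun e => hab (congrArg Subtype.val e)⟩

end Gluing

theorem theorem4p5 (K : Type*) [Field K] {V₁ V₂ : Type*} [Fintype V₁] [Fintype V₂]
    (G₁ : SimpleGraph V₁) (G₂ : SimpleGraph V₂) [DecidableRel G₁.Adj] [DecidableRel G₂.Adj]
    (hG₁ : G₁.Connected) (hG₂ : G₂.Connected) (f₁ v₁ : V₁) (f₂ v₂ : V₂)
    (hf₁ : G₁.degree f₁ = 1) (hfv₁ : G₁.Adj f₁ v₁) (hv₁ : 3 ≤ G₁.degree v₁)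
    (hf₂ : G₂.degree f₂ = 1) (hfv₂ : G₂.Adj f₂ v₂) (hv₂ : 3 ≤ G₂.degree v₂) :
    -- cut sets of `G₁ ∘ G₂`, regarded as subsets of the glued vertex set
    ((∃ u₁, G₁.Adj v₁ u₁ ∧ G₁.degree u₁ = 2) → (∃ u₂, G₂.Adj v₂ u₂ ∧ G₂.degree u₂ = 2) →
      (fun S => Subtype.val '' S) '' cutSets K (circ G₁ G₂ f₁ v₁ f₂ v₂) =
        gluedCutSets K G₁ G₂ v₁ v₂) ∧
    -- unmixedness of `G₁ ∘ G₂`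
    ((∃ u₁, G₁.Adj v₁ u₁ ∧ G₁.degree u₁ = 2) → (∃ u₂, G₂.Adj v₂ u₂ ∧ G₂.degree u₂ = 2) →
      (binomialEdgeIdeal K G₁).IsUnmixed → (binomialEdgeIdeal K G₂).IsUnmixed →
      (binomialEdgeIdeal K (circ G₁ G₂ f₁ v₁ f₂ v₂)).IsUnmixed) ∧
    -- the converse, and the description of the cut sets, for bipartite graphs
    ((circ G₁ G₂ f₁ v₁ f₂ v₂).IsBipartite →
      (binomialEdgeIdeal K (circ G₁ G₂ f₁ v₁ f₂ v₂)).IsUnmixed →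
      (binomialEdgeIdeal K G₁).IsUnmixed ∧ (binomialEdgeIdeal K G₂).IsUnmixed ∧
      (∃ u₁, G₁.Adj v₁ u₁ ∧ G₁.degree u₁ = 2) ∧ (∃ u₂, G₂.Adj v₂ u₂ ∧ G₂.degree u₂ = 2) ∧
      (fun S => Subtype.val '' S) '' cutSets K (circ G₁ G₂ f₁ v₁ f₂ v₂) =
        gluedCutSets K G₁ G₂ v₁ v₂) := by
  have hl₁ := eq_of_adj_of_degree_eq_one hf₁ hfv₁
  have hl₂ := eq_of_adj_of_degree_eq_one hf₂ hfv₂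
  have hw : SimpleGraph.IsWedge (G₁.induce {f₁}ᶜ) (G₂.induce {f₂}ᶜ) (circ G₁ G₂ f₁ v₁ f₂ v₂) _ _ _ _ :=
    isWedge_circ hfv₁.ne hfv₂.ne
  have hc₁ := connected_induce_of_leaf hG₁ hfv₁ hl₁
  have hc₂ := connected_induce_of_leaf hG₂ hfv₂ hl₂
  have hc := hw.connected hc₁ hc₂
  rw [exists_degree_eq_two_iff hfv₁ hl₁, exists_degree_eq_two_iff hfv₂ hl₂,
    isUnmixed_iff_of_leaf hG₁ hfv₁ hl₁, isUnmixed_iff_of_leaf hG₂ hfv₂ hl₂,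
    isUnmixed_iff_defect hw hc]
  refine ⟨image_cutSets_circ hfv₁ hl₁ hfv₂ hl₂, ?_, ?_⟩
  · rintro ⟨u₁, hu₁⟩ ⟨u₂, hu₂⟩ hU₁ hU₂ S hS
    obtain ⟨hP₁, hP₂⟩ := (hw.forall_cutAt_iff hu₁ hu₂).mp hS
    rw [hU₁ _ hP₁, hU₂ _ hP₂, add_zero]
  · intro hbip hU
    obtain ⟨a₁, b₁, ha₁, hb₁, hab₁⟩ := exists_two_neighbors_of_leaf hfv₁ hv₁
    obtain ⟨a₂, b₂, ha₂, hb₂, hab₂⟩ := exists_two_neighbors_of_leaf hfv₂ hv₂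
    have hU' : ∀ S, (∀ x ∈ S, (circ G₁ G₂ f₁ v₁ f₂ v₂).CutAt S x) → _ :=
      fun S hS => (add_comm _ _).trans (hU S hS)
    obtain ⟨c⟩ := hbip
    -- The colour class of the common vertex; being symmetric in the two sides, it serves for both
    -- applications.
    let D (x : circVerts f₁ v₁ f₂ v₂) : Prop := c x = c (circLeft f₁ v₁ hfv₂.ne ⟨v₁, hfv₁.ne'⟩)
    have hD (x y) (hxy : (circ G₁ G₂ f₁ v₁ f₂ v₂).Adj x y) : D x ↔ ¬ D y := by
      have := c.valid hxy
      simp only [D]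
      omega
    have hu₁ := hw.exists_isDegreeTwoNeighbor_left hc₁ hc₂ hD rfl hU ha₁ hb₁ hab₁ ha₂ hb₂ hab₂
    have hu₂ := hw.symm.exists_isDegreeTwoNeighbor_left hc₂ hc₁ hD (congrArg c hw.point.symm) hU'
      ha₂ hb₂ hab₂ ha₁ hb₁ hab₁
    exact ⟨fun S hS => hw.defect_left_eq_zero hc₂ hU ha₁ ha₂ hS,
      fun S hS => hw.symm.defect_left_eq_zero hc₁ hU' ha₂ ha₁ hS, hu₁, hu₂,
      image_cutSets_circ hfv₁ hl₁ hfv₂ hl₂ hu₁ hu₂⟩
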